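/- There is a universal constant $C>0$ such that the following holds. Let $\mathcal G=(\mathcal X^2,\mathcal A^2,\mu,V)$ be a synchronous nonlocal game: $\mathcal X$ and $\mathcal A$ are finite sets of questions and answers, $\mu$ is a probability distribution on $\mathcal X^2$, and $V:\mathcal X^2\times\mathcal A^2\to\{0,1\}$ satisfies $V(x,x,a,b)=\delta_{a,b}$ for all $x,a,b$. Write $\mathbb E_x$ for the expectation over the first marginal of $\mu$. Let $\mathscr A\subseteq\mathcal B(\mathcal H)$ be a tracial von Neumann algebra in standard form: there is a unit vector $|\tau\rangle\in\mathcal H$, cyclic and separating for $\mathscr A$, such that $\tau(a)=\langle\tau|a|\tau\rangle$ satisfies $\tau(ab)=\tau(ba)$ for $a,b\in\mathscr A$ (so $\mathcal H=\mathcal L^2(\mathscr A,\tau)$). For $a\in\mathscr A$ let $\|a\|_2=\sqrt{\tau(a^*a)}$, and let $a^{op}\in\mathscr A'$ be the bounded operator with $a^{op}(b|\tau\rangle)=ba|\tau\rangle$ for all $b\in\mathscr A$. Let $\sigma\in\mathscr A$ be positive with $\|\sigma|\tau\rangle\|=1$, and for each $x\in\mathcal X$ let $\{A^x_a\}_{a\in\mathcal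 A}\subseteq\mathscr A$ be a PVM (projections with $\sum_aA^x_a=1$). Consider the projective symmetric strategy with state $\sigma|\tau\rangle$, Alice's operators $A^x_a$ and Bob's operators $(A^x_a)^{op}$, and suppose that it is $\delta$-synchronous: $$\mathbb E_x\sum_{a\neq b}\langle\tau|\sigma\,A^x_a\,(A^x_b)^{op}\,\sigma|\tau\rangle\le\delta .$$ Then the spectral projections $P_\lambda=\chi_{\ge\sqrt\lambda}(\sigma)$, $\lambda\ge0$, are projections in $\mathscr A$ with $$\int_0^\infty P_\lambda\,d\lambda=\sigma^2$$ (as a weak integral: $\int_0^\infty\langle v|P_\lambda|w\rangle\,d\lambda=\langle v|\sigma^2|w\rangle$ for all $v,w\in\mathcal H$, with integrable integrands), and for every $\lambda\ge0$ and $x\in\mathcal X$ there is a PVM $\{A^{\lambda,x}_a\}_{a\in\mathcal A}$ in the corner $P_\lambda\mathscr AP_\lambda$ (projections in $P_\lambda\mathscr AP_\lambda$ with $\sum_aA^{\lambda,x}_a=P_\lambda$) such that the function $\lambda\mapsto\mathbb E_x\sum_a\|(A^x_a-A^{\lambda,x}_a)P_\lambda\|_2^2$ is integrable on $(0,\infty)$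 and $$\int_0^\infty\mathbb E_x\sum_{a\in\mathcal A}\big\|(A^x_a-A^{\lambda,x}_a)P_\lambda\big\|_2^2\,d\lambda\le C\,\delta^{1/4}.$$ -/

import Mathlib

open MeasureTheory

universe u v w

noncomputable section

namespace Rounding

/-! ### Nonlocal games -/

/-- A two-player nonlocal game with (common) question set `X` and answer set `A`: a probability
distribution `μ` on pairs of questions and a `{0,1}`-valued evaluation `V x y a b`. -/
structure NonlocalGame (X : Type u) (A : Type v) [Fintype X] where
  μ : X → X → ℝ
  μ_nonneg : ∀ x y, 0 ≤ μ x y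
  μ_sum : ∑ x, ∑ y, μ x y = 1
  V : X → X → A → A → Bool

namespace NonlocalGame

variable {X : Type u} {A : Type v} [Fintype X]

/-- `V (x, x, a, b) = δ_{a,b}` for all questions `x`. -/
def IsSynchronous (G : NonlocalGame X A) : Prop :=
  ∀ x a b, G.V x x a b = true ↔ a = b

/-- The marginal distribution of the first question. -/
def marginal (G : NonlocalGame X A) (x : X) : ℝ := ∑ y, G.μ x y

/-- Expectation over the marginal distribution of the first question. -/
def expect (G : NonlocalGame X A) (f : X → ℝ) : ℝ := ∑ x, G.marginal x * f x

end NonlocalGame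

/-! ### Measurements and commuting operator strategies -/

variable {H : Type w} [NormedAddCommGroup H] [InnerProductSpace ℂ H] [CompleteSpace H]

/-- A POVM on `H`: finitely many positive operators that sum to the identity. -/
structure IsPOVM {A : Type v} [Fintype A] (E : A → H →L[ℂ] H) : Prop where
  pos : ∀ a, (E a).IsPositive
  sum_eq : ∑ a, E a = 1

/-- A PVM on `H`: a POVM that consists of projections. -/
structure IsPVM {A : Type v} [Fintype A] (E : A → H →L[ℂ] H) : Prop extends IsPOVM E where
  idem : ∀ a, E a * E a = E a

/-- A commuting operator strategy on the Hilbert space `H`. -/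
structure Strategy (H : Type w) [NormedAddCommGroup H] [InnerProductSpace ℂ H] [CompleteSpace H]
    (X : Type u) (A : Type v) [Fintype X] [Fintype A] where
  ψ : H
  norm_ψ : ‖ψ‖ = 1
  alice : X → A → H →L[ℂ] H
  bob : X → A → H →L[ℂ] H
  alice_povm : ∀ x, IsPOVM (alice x)
  bob_povm : ∀ y, IsPOVM (bob y)
  comm : ∀ x y a b, alice x a * bob y b = bob y b * alice x a

namespace Strategy

variable {X : Type u} {A : Type v} [Fintype X] [Fintype A]

/-- The correlation `C_{x,y,a,b} = ⟨ψ| A^x_a B^y_b |ψ⟩` (a real number, since the two operators are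
positive and commute). -/
def correlation (S : Strategy H X A) (x y : X) (a b : A) : ℝ :=
  (inner ℂ S.ψ ((S.alice x a * S.bob y b) S.ψ)).re

/-- The synchronicity `E_x ∑_{a ≠ b} C_{x,x,a,b}` of the strategy in the game `G`. -/
def synchronicity [DecidableEq A] (G : NonlocalGame X A) (S : Strategy H X A) : ℝ :=
  G.expect fun x => ∑ a, ∑ b, if a ≠ b then S.correlation x x a b else 0

/-- The strategy is `δ`-synchronous for the game `G`. -/
def IsDeltaSynchronous [DecidableEq A] (G : NonlocalGame X A) (S : Strategy H X A) (δ : ℝ) : Prop :=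
  S.synchronicity G ≤ δ

/-- All measurements of the strategy are projective. -/
structure IsProjective (S : Strategy H X A) : Prop where
  alice : ∀ x, IsPVM (S.alice x)
  bob : ∀ y, IsPVM (S.bob y)

end Strategy

/-! ### Tracial von Neumann algebras in standard form -/

/-- The vector functional `τ(a) = ⟨Ω| a |Ω⟩`. -/
def vectorState (Ω : H) (a : H →L[ℂ] H) : ℂ := inner ℂ Ω (a Ω)

/-- `𝒜 ⊆ B(H)` is a tracial von Neumann algebra in standard form with vector `|τ⟩ = Ω`: the unit
vector `Ω` is cyclic and separating for `𝒜`, and `τ(a) = ⟨Ω| a |Ω⟩` is a trace on `𝒜`. Then `τ`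
is a faithful normal tracial state on `𝒜` with GNS triplet `(id, H, Ω)`; conversely, the GNS
triplet of every faithful normal tracial state is of this form. -/
structure IsTracialStandardForm (𝒜 : VonNeumannAlgebra H) (Ω : H) : Prop where
  norm_eq_one : ‖Ω‖ = 1
  tracial : ∀ a ∈ 𝒜, ∀ b ∈ 𝒜, vectorState Ω (a * b) = vectorState Ω (b * a)
  cyclic : Dense {v : H | ∃ a ∈ 𝒜, v = a Ω}
  separating : ∀ a ∈ 𝒜, a Ω = 0 → a = 0

/-- The Hilbert-Schmidt norm `‖a‖₂ = √τ(a* a)`. -/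
def twoNorm (Ω : H) (a : H →L[ℂ] H) : ℝ := Real.sqrt (vectorState Ω (star a * a)).re

/-- The map `𝒜 → H`, `b ↦ b (a Ω)`. -/
def orbitMap (𝒜 : VonNeumannAlgebra H) (Ω : H) (a : H →L[ℂ] H) :
    𝒜.toStarSubalgebra →ₗ[ℂ] H where
  toFun b := (b : H →L[ℂ] H) (a Ω)
  map_add' _ _ := by simp
  map_smul' _ _ := by simp

/-- The right multiplication operator `a^op`, the bounded operator on `H` determined by
`a^op (b Ω) = (b a) Ω` for `b ∈ 𝒜` (see `opMap_apply`). -/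
def opMap (𝒜 : VonNeumannAlgebra H) (Ω : H) (a : H →L[ℂ] H) : H →L[ℂ] H :=
  (orbitMap 𝒜 Ω a).extendOfNorm (orbitMap 𝒜 Ω 1)

theorem norm_apply_star_eq {𝒜 : VonNeumannAlgebra H} {Ω : H} (h : IsTracialStandardForm 𝒜 Ω)
    {c : H →L[ℂ] H} (hc : c ∈ 𝒜) : ‖(star c) Ω‖ = ‖c Ω‖ := by
  have h1 := h.tracial c hc (star c) (star_mem hc)
  have key : ∀ d : H →L[ℂ] H, vectorState Ω (star d * d) = (‖d Ω‖ : ℂ) ^ 2 := fun d => by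
    rw [vectorState, mul_apply_eq_comp, ContinuousLinearMap.star_eq_adjoint,
      ContinuousLinearMap.adjoint_inner_right, inner_self_eq_norm_sq_to_K]
    rfl
  have h2 := key (star c)
  rw [star_star, h1, key c] at h2
  have h3 : ‖c Ω‖ ^ 2 = ‖(star c) Ω‖ ^ 2 := by exact_mod_cast h2
  exact ((sq_eq_sq₀ (norm_nonneg _) (norm_nonneg _)).1 h3).symm

theorem opMap_apply {𝒜 : VonNeumannAlgebra H} {Ω : H} (h : IsTracialStandardForm 𝒜 Ω)
    {a b : H →L[ℂ] H} (ha : a ∈ 𝒜) (hb : b ∈ 𝒜) : opMap 𝒜 Ω a (b Ω) = (b * a) Ω := by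
  have hd : DenseRange (orbitMap 𝒜 Ω 1) := by
    refine h.cyclic.mono ?_
    rintro v ⟨c, hc, rfl⟩
    exact ⟨⟨c, hc⟩, rfl⟩
  have hn : ∃ C, ∀ x, ‖orbitMap 𝒜 Ω a x‖ ≤ C * ‖orbitMap 𝒜 Ω 1 x‖ := by
    refine ⟨‖a‖, fun x => ?_⟩
    obtain ⟨c, hc⟩ := x
    have hc' : c ∈ 𝒜 := hc
    change ‖(c * a) Ω‖ ≤ ‖a‖ * ‖c Ω‖
    rw [← norm_apply_star_eq h (mul_mem hc' ha), ← norm_apply_star_eq h hc', star_mul]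
    simpa using (star a).le_opNorm ((star c) Ω)
  exact LinearMap.extendOfNorm_eq hd hn (⟨b, hb⟩ : 𝒜.toStarSubalgebra)

/-- `S` is a tracial embedded strategy on the standard form `(𝒜, Ω)` with state `σ |τ⟩`. -/
structure IsTracialEmbedded {X : Type u} {A : Type v} [Fintype X] [Fintype A]
    (𝒜 : VonNeumannAlgebra H) (Ω : H) (σ : H →L[ℂ] H) (S : Strategy H X A) : Prop where
  mem : σ ∈ 𝒜
  state_eq : S.ψ = σ Ω
  alice_mem : ∀ x a, S.alice x a ∈ 𝒜
  bob_mem : ∀ y b, S.bob y b ∈ 𝒜.commutant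

/-- `S` is the symmetric strategy `(L²(𝒜, τ), σ |τ⟩, {A^x_a})`: a tracial embedded strategy
in which Bob's operators are the opposites of Alice's. -/
structure IsSymmetric {X : Type u} {A : Type v} [Fintype X] [Fintype A]
    (𝒜 : VonNeumannAlgebra H) (Ω : H) (σ : H →L[ℂ] H) (S : Strategy H X A) : Prop
    extends IsTracialEmbedded 𝒜 Ω σ S where
  bob_eq : ∀ x a, S.bob x a = opMap 𝒜 Ω (S.alice x a)

/-! ### Spectral projections, corners, operator-valued integrals -/

/-- The spectral projection `χ_{≥ t}(σ)` of a self-adjoint operator `σ`. Since `[t, ∞)` is the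
zero set of the continuous function `x ↦ max (t - x) 0`, it is the orthogonal projection onto the
kernel of `(t - σ)⁺`. -/
def spectralProjGE (σ : H →L[ℂ] H) (t : ℝ) : H →L[ℂ] H :=
  let T : H →L[ℂ] H := cfc (fun x : ℝ => max (t - x) 0) σ
  haveI : CompleteSpace (LinearMap.ker (T : H →ₗ[ℂ] H)) := T.isClosed_ker.completeSpace_coe
  (LinearMap.ker (T : H →ₗ[ℂ] H)).starProjection

/-- The corner `P 𝒜 P`. -/
def corner (𝒜 : VonNeumannAlgebra H) (P : H →L[ℂ] H) : Set (H →L[ℂ] H) :=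
  {b | ∃ a ∈ 𝒜, b = P * a * P}

/-- A PVM in the corner `P 𝒜 P`, whose unit is the projection `P`. -/
structure IsCornerPVM {A : Type v} [Fintype A] (𝒜 : VonNeumannAlgebra H) (P : H →L[ℂ] H)
    (E : A → H →L[ℂ] H) : Prop where
  mem : ∀ a, E a ∈ corner 𝒜 P
  proj : ∀ a, IsStarProjection (E a)
  sum_eq : ∑ a, E a = P

/-- `∫_0^∞ F(t) dt = T` as a (weak) integral of operators. -/
def HasOperatorIntegral (F : ℝ → H →L[ℂ] H) (T : H →L[ℂ] H) : Prop :=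
  ∀ v w : H, IntegrableOn (fun t => inner ℂ v (F t w)) (Set.Ioi 0) ∧
    ∫ t in Set.Ioi (0 : ℝ), inner ℂ v (F t w) = inner ℂ v (T w)

end Rounding

end

/-! Write s for the synchronicity of the strategy and ‖·‖₂ for the trace norm of order two. The
correlations are τ(σ A_a σ A_b), so expanding squares gives E_x ∑_a ‖[A^x_a, σ]‖₂² = 2s
(`IsSymmetric.sum_commutator_eq`). PVMs that almost commute with `σ` must be rounded into the
corners of its spectral projections.

On average over the level λ, these projections almost commute with the PVMs as well. This is Connes'
joint distribution argument (`IsPVMIn.sum_commutator_grid_le`). Let `σ` have eigenvalues t_i and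
eigenprojections E_i, and put w(i,j) = E_x ∑_a ‖E_i A^x_a E_j‖₂²; both marginals of w are ‖E_i‖₂².
The squared commutator with f(σ) is ∑ w(i,j) (f(t_i) - f(t_j))². For f the indicator of t² ≥ λ,
integration over λ turns this into ∑ w(i,j) |t_i² - t_j²|. Factoring |t_i² - t_j²| and applying
Cauchy-Schwarz bounds it by a multiple of √s.

At one level, let P be a projection, e a PVM and ε = ∑_a ‖[e_a, P]‖₂². A spectral projection p of
the pinching ∑ e_a P e_a commutes with e and satisfies ‖P - p‖₂² ≤ 2ε
(`IsPVMIn.exists_commuting_projection`). A unitary W with ‖W - 1‖₂² = O(ε) moves P into the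
commutant of e (`IsPVMIn.exists_unitary_near_one`). Hence W* e_a W commutes with P and cuts down to
a PVM in the corner, and the total error is at most 4‖W - 1‖₂², whatever the number of answers
(`IsPVMIn.exists_cornerPVM`). The symmetry sgn(P + p - 1) exchanges P and p except on the kernel n
of P + p - 1, where p = 1 - P. Since n has trace O(ε), a second unitary, in the commutant of p,
moves n into the commutant of e at a cost linear in its trace (`exists_unitary_conj_commute`).

The levels are discretized by a grid of mesh η in the spectrum of σ² (`exists_rounding`). Thus only
finitely many roundings are chosen, the integrand is measurable, and no joint spectral measure is
needed. The mesh costs O(η) inside the square root and O(η) outside; η = s gives a total of O(√s),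
which is stronger than δ^(1/4) because s ≤ 1 and s ≤ δ. -/

noncomputable section

namespace Rounding

variable {H : Type w} [NormedAddCommGroup H] [InnerProductSpace ℂ H] [CompleteSpace H]

/-! ### Kernel projections and spectral projections -/

/-- The orthogonal projection onto the kernel of `T`. -/
def kerProj (T : H →L[ℂ] H) : H →L[ℂ] H :=
  haveI : CompleteSpace (LinearMap.ker (T : H →ₗ[ℂ] H)) := T.isClosed_ker.completeSpace_coe
  (LinearMap.ker (T : H →ₗ[ℂ] H)).starProjection

theorem isStarProjection_kerProj (T : H →L[ℂ] H) : IsStarProjection (kerProj T) := by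
  have : CompleteSpace (LinearMap.ker (T : H →ₗ[ℂ] H)) := T.isClosed_ker.completeSpace_coe
  exact isStarProjection_starProjection

theorem mul_kerProj (T : H →L[ℂ] H) : T * kerProj T = 0 := by
  have : CompleteSpace (LinearMap.ker (T : H →ₗ[ℂ] H)) := T.isClosed_ker.completeSpace_coe
  ext v
  exact LinearMap.mem_ker.1 ((LinearMap.ker (T : H →ₗ[ℂ] H)).starProjection_apply_mem v)

theorem kerProj_mul {T X : H →L[ℂ] H} (h : T * X = 0) : kerProj T * X = X := by
  have : CompleteSpace (LinearMap.ker (T : H →ₗ[ℂ] H)) := T.isClosed_ker.completeSpace_coe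
  ext v
  refine Submodule.starProjection_eq_self_iff.2 (LinearMap.mem_ker.2 ?_)
  exact DFunLike.congr_fun h v

theorem kerProj_mul_self {T : H →L[ℂ] H} (hT : IsSelfAdjoint T) : kerProj T * T = 0 := by
  have := congrArg star (mul_kerProj T)
  rwa [star_mul, hT.star_eq, (isStarProjection_kerProj T).isSelfAdjoint.star_eq, star_zero] at this

theorem mul_kerProj_of_mul_eq_zero {T X : H →L[ℂ] H} (hT : IsSelfAdjoint T) (h : X * T = 0) :
    X * kerProj T = X := by
  have h1 : T * star X = 0 := by
    have := congrArg star h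
    rwa [star_mul, hT.star_eq, star_zero] at this
  have := congrArg star (kerProj_mul h1)
  rwa [star_mul, star_star, (isStarProjection_kerProj T).isSelfAdjoint.star_eq] at this

/-- Both `y` and `star y` leave the kernel of `T` invariant, so the kernel reduces `y`. -/
theorem commute_kerProj {T y : H →L[ℂ] H} (h1 : Commute y T) (h2 : Commute (star y) T) :
    Commute y (kerProj T) := by
  have key : ∀ z, Commute z T → kerProj T * (z * kerProj T) = z * kerProj T := fun z hz => by
    apply kerProj_mul
    rw [← mul_assoc, ← hz.eq, mul_assoc, mul_kerProj, mul_zero]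
  have h3 := key y h1
  have h4 := congrArg star (key (star y) h2)
  simp only [star_mul, star_star, (isStarProjection_kerProj T).isSelfAdjoint.star_eq] at h4
  rw [mul_assoc] at h4
  exact h3.symm.trans h4

/-- The bicommutant property. Kernel projections and functions of elements of `𝒜` stay in `𝒜`
because of it. -/
theorem mem_of_commute {𝒜 : VonNeumannAlgebra H} {x : H →L[ℂ] H}
    (h : ∀ y ∈ 𝒜.commutant, Commute y x) : x ∈ 𝒜 := by
  rw [← 𝒜.commutant_commutant, VonNeumannAlgebra.mem_commutant_iff]
  exact fun y hy => h y hy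

theorem commute_of_mem_commutant {𝒜 : VonNeumannAlgebra H} {x y : H →L[ℂ] H} (hx : x ∈ 𝒜)
    (hy : y ∈ 𝒜.commutant) : Commute y x :=
  ((VonNeumannAlgebra.mem_commutant_iff.1 hy) x hx).symm

theorem kerProj_mem {𝒜 : VonNeumannAlgebra H} {T : H →L[ℂ] H} (hT : T ∈ 𝒜) : kerProj T ∈ 𝒜 :=
  mem_of_commute fun _ hy =>
    commute_kerProj (commute_of_mem_commutant hT hy) (commute_of_mem_commutant hT (star_mem hy))

theorem cfc_mem {𝒜 : VonNeumannAlgebra H} {T : H →L[ℂ] H} (hT : T ∈ 𝒜) (f : ℝ → ℝ) :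
    cfc f T ∈ 𝒜 :=
  mem_of_commute fun _ hy => ((commute_of_mem_commutant hT hy).symm.cfc_real f).symm

theorem isStarProjection_spectralProjGE (σ : H →L[ℂ] H) (t : ℝ) :
    IsStarProjection (spectralProjGE σ t) := isStarProjection_kerProj _

theorem spectralProjGE_mem {𝒜 : VonNeumannAlgebra H} {σ : H →L[ℂ] H} (hσ : σ ∈ 𝒜) (t : ℝ) :
    spectralProjGE σ t ∈ 𝒜 := kerProj_mem (cfc_mem hσ _)

theorem commute_spectralProjGE {T y : H →L[ℂ] H} (h1 : Commute y T) (h2 : Commute (star y) T)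
    (t : ℝ) : Commute y (spectralProjGE T t) :=
  commute_kerProj (h1.symm.cfc_real _).symm (h2.symm.cfc_real _).symm

theorem spectralProjGE_mul_negPart (σ : H →L[ℂ] H) (t : ℝ) :
    spectralProjGE σ t * cfc (fun x : ℝ => max (t - x) 0) σ = 0 :=
  kerProj_mul_self (cfc_predicate _ _)

theorem spectralProjGE_mul_posPart (σ : H →L[ℂ] H) (t : ℝ) :
    spectralProjGE σ t * cfc (fun x : ℝ => max (x - t) 0) σ = cfc (fun x : ℝ => max (x - t) 0) σ := by
  apply kerProj_mul
  rw [← cfc_mul _ _ σ (by fun_prop) (by fun_prop)]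
  have : (fun x : ℝ => max (t - x) 0 * max (x - t) 0) = fun _ => 0 := by
    ext x
    rcases le_total x t with h | h
    · rw [max_eq_right (sub_nonpos.2 h), mul_zero]
    · rw [max_eq_right (sub_nonpos.2 h), zero_mul]
  rw [this]
  exact cfc_const_zero ℝ σ

theorem sub_algebraMap_eq {σ : H →L[ℂ] H} (hσ : IsSelfAdjoint σ) (t : ℝ) :
    σ - algebraMap ℝ _ t
      = cfc (fun x : ℝ => max (x - t) 0) σ - cfc (fun x : ℝ => max (t - x) 0) σ := by
  rw [← cfc_sub _ _ σ (by fun_prop) (by fun_prop)]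
  have h1 : (fun x : ℝ => max (x - t) 0 - max (t - x) 0) = fun x => id x - t := by
    ext x
    rcases le_total x t with h | h
    · rw [max_eq_right (sub_nonpos.2 h), max_eq_left (sub_nonneg.2 h)]; simp
    · rw [max_eq_right (sub_nonpos.2 h), max_eq_left (sub_nonneg.2 h)]; simp
  rw [h1, cfc_sub _ _ σ (by fun_prop) (by fun_prop), cfc_id ℝ σ, cfc_const t σ]

/-- The indicator of [t, ∞) is discontinuous, but its product with x - t is the continuous function
(x - t)⁺. This identity brings spectral projections within reach of the continuous functional
calculus. -/
theorem spectralProjGE_mul_sub {σ : H →L[ℂ] H} (hσ : IsSelfAdjoint σ) (t : ℝ) :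
    spectralProjGE σ t * (σ - algebraMap ℝ _ t) = cfc (fun x : ℝ => max (x - t) 0) σ := by
  rw [sub_algebraMap_eq hσ, mul_sub, spectralProjGE_mul_negPart, sub_zero,
    spectralProjGE_mul_posPart]

theorem one_sub_spectralProjGE_mul_sub {σ : H →L[ℂ] H} (hσ : IsSelfAdjoint σ) (t : ℝ) :
    (1 - spectralProjGE σ t) * (algebraMap ℝ _ t - σ) = cfc (fun x : ℝ => max (t - x) 0) σ := by
  rw [← neg_sub σ, mul_neg, sub_mul, one_mul, spectralProjGE_mul_sub hσ, sub_algebraMap_eq hσ]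
  abel

/-! ### Two projections -/

/-- The symmetry `sgn (c + d - 1)`. -/
def swapSymm (c d : H →L[ℂ] H) : H →L[ℂ] H := 2 * spectralProjGE (c + d - 1) 0 - 1

/-- The projection onto the kernel of `c + d - 1`. -/
def swapKer (c d : H →L[ℂ] H) : H →L[ℂ] H := kerProj (c + d - 1)

section TwoProjections

variable {c d : H →L[ℂ] H}

theorem isSelfAdjoint_add_sub_one (hc : IsStarProjection c) (hd : IsStarProjection d) :
    IsSelfAdjoint (c + d - 1) :=
  (hc.isSelfAdjoint.add hd.isSelfAdjoint).sub (IsSelfAdjoint.one _)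

theorem isStarProjection_swapKer (c d : H →L[ℂ] H) : IsStarProjection (swapKer c d) :=
  isStarProjection_kerProj _

theorem add_sub_one_mul_left (hc : IsStarProjection c) : (c + d - 1) * c = d * c := by
  rw [sub_mul, add_mul, hc.isIdempotentElem.eq, one_mul]; abel

theorem add_sub_one_mul_right (hd : IsStarProjection d) : (c + d - 1) * d = c * d := by
  rw [sub_mul, add_mul, hd.isIdempotentElem.eq, one_mul]; abel

theorem mul_add_sub_one_left (hc : IsStarProjection c) : c * (c + d - 1) = c * d := by
  rw [mul_sub, mul_add, hc.isIdempotentElem.eq, mul_one]; abel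

theorem mul_add_sub_one_right (hd : IsStarProjection d) : d * (c + d - 1) = d * c := by
  rw [mul_sub, mul_add, hd.isIdempotentElem.eq, mul_one]; abel

theorem swapKer_comm (c d : H →L[ℂ] H) : swapKer c d = swapKer d c := by
  rw [swapKer, swapKer, add_comm]

theorem commute_swapKer_left (hc : IsStarProjection c) (hd : IsStarProjection d) :
    Commute c (swapKer c d) := by
  have h1 : swapKer c d * (c * swapKer c d) = c * swapKer c d := by
    apply kerProj_mul
    rw [← mul_assoc, add_sub_one_mul_left hc, ← mul_add_sub_one_right hd, mul_assoc, swapKer,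
      mul_kerProj, mul_zero]
  have h2 := congrArg star h1
  simp only [star_mul, hc.isSelfAdjoint.star_eq,
    (isStarProjection_swapKer c d).isSelfAdjoint.star_eq] at h2
  rw [mul_assoc] at h2
  exact h1.symm.trans h2

theorem commute_swapKer_right (hc : IsStarProjection c) (hd : IsStarProjection d) :
    Commute d (swapKer c d) := by
  rw [swapKer_comm]; exact commute_swapKer_left hd hc

/-- On the kernel of c + d - 1 the two projections are complementary. This is the part on which the
symmetry cannot exchange them. -/
theorem mul_swapKer (c d : H →L[ℂ] H) : d * swapKer c d = (1 - c) * swapKer c d := by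
  have := mul_kerProj (c + d - 1)
  rw [← sub_eq_zero, ← sub_mul, swapKer, ← this]
  congr 1; abel

theorem isSelfAdjoint_swapSymm (c d : H →L[ℂ] H) : IsSelfAdjoint (swapSymm c d) := by
  have := (isStarProjection_spectralProjGE (c + d - 1) 0).isSelfAdjoint
  rw [swapSymm, two_mul]
  exact (this.add this).sub (IsSelfAdjoint.one _)

theorem two_mul_sub_one_sq {p : H →L[ℂ] H} (hp : IsStarProjection p) :
    (2 * p - 1) * (2 * p - 1) = 1 := by
  have := hp.isIdempotentElem.eq
  have h2 : (2 * p - 1) * (2 * p - 1) = 4 * (p * p) - 4 * p + 1 := by noncomm_ring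
  rw [h2, this]; abel

theorem swapSymm_mul_self (c d : H →L[ℂ] H) : swapSymm c d * swapSymm c d = 1 :=
  two_mul_sub_one_sq (isStarProjection_spectralProjGE _ _)

/-- The half-line [0, ∞) contains its endpoint, so the symmetry equals 1 on the kernel. -/
theorem spectralProjGE_mul_swapKer (hc : IsStarProjection c) (hd : IsStarProjection d) :
    spectralProjGE (c + d - 1) 0 * swapKer c d = swapKer c d := by
  have hS := isSelfAdjoint_add_sub_one hc hd
  apply kerProj_mul
  set T := cfc (fun x : ℝ => max (0 - x) 0) (c + d - 1) with hT
  have hTs : IsSelfAdjoint T := cfc_predicate _ _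
  -- The negative part satisfies (x⁻)² = -x⁻ x, hence `T` vanishes wherever c + d - 1 does.
  have h1 : T * T = - (T * (c + d - 1)) := by
    conv_rhs => rw [← cfc_id ℝ (c + d - 1)]
    rw [hT, ← cfc_mul _ _ _ (by fun_prop) (by fun_prop),
      ← cfc_mul _ _ _ (by fun_prop) (by fun_prop), ← cfc_neg]
    congr 1
    ext x
    rcases le_total x 0 with h | h
    · rw [max_eq_left (by linarith)]; simp
    · rw [max_eq_right (by linarith)]; simp
  rw [← CStarRing.star_mul_self_eq_zero_iff, star_mul, hTs.star_eq, mul_assoc,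
    ← mul_assoc T T, h1, neg_mul, mul_assoc T, swapKer, mul_kerProj]
  simp

theorem swapSymm_mul_swapKer (hc : IsStarProjection c) (hd : IsStarProjection d) :
    swapSymm c d * swapKer c d = swapKer c d := by
  rw [swapSymm, sub_mul, mul_assoc, spectralProjGE_mul_swapKer hc hd, one_mul, two_mul]; abel

theorem swapKer_mul_swapSymm (hc : IsStarProjection c) (hd : IsStarProjection d) :
    swapKer c d * swapSymm c d = swapKer c d := by
  have := congrArg star (swapSymm_mul_swapKer hc hd)
  rwa [star_mul, (isSelfAdjoint_swapSymm c d).star_eq,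
    (isStarProjection_swapKer c d).isSelfAdjoint.star_eq] at this

theorem swapSymm_mul (hc : IsStarProjection c) (hd : IsStarProjection d) :
    swapSymm c d * (c + d - 1) = cfc (fun x : ℝ => |x|) (c + d - 1) := by
  have hS := isSelfAdjoint_add_sub_one hc hd
  have h := spectralProjGE_mul_sub hS 0
  rw [map_zero, sub_zero] at h
  rw [swapSymm, sub_mul, mul_assoc, h, one_mul, two_mul]
  conv_lhs => rw [← cfc_id ℝ (c + d - 1)]
  rw [cfc_id ℝ (c + d - 1)]
  nth_rw 3 [← cfc_id ℝ (c + d - 1)]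
  rw [← cfc_add _ _ _ (by fun_prop) (by fun_prop), ← cfc_sub _ _ _ (by fun_prop) (by fun_prop)]
  congr 1
  ext x
  rcases le_total x 0 with h | h
  · rw [max_eq_right (by linarith), abs_of_nonpos h]; simp
  · rw [max_eq_left (by linarith), abs_of_nonneg h]; simp

theorem swapSymm_mul_abs (hc : IsStarProjection c) (hd : IsStarProjection d) :
    swapSymm c d * cfc (fun x : ℝ => |x|) (c + d - 1) = c + d - 1 := by
  rw [← swapSymm_mul hc hd, ← mul_assoc, swapSymm_mul_self, one_mul]

/-- The square of c + d - 1 commutes with `c`, because both products equal c d c; the modulus is the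
root of that square. -/
theorem commute_abs_left (hc : IsStarProjection c) (hd : IsStarProjection d) :
    Commute (cfc (fun x : ℝ => |x|) (c + d - 1)) c := by
  have hS := isSelfAdjoint_add_sub_one hc hd
  have h1 : (fun x : ℝ => |x|) = fun x => Real.sqrt (x ^ 2) := by
    ext x; rw [Real.sqrt_sq_eq_abs]
  have h2 : Commute ((c + d - 1) ^ 2) c := by
    show (c + d - 1) ^ 2 * c = c * (c + d - 1) ^ 2
    rw [sq, mul_assoc, add_sub_one_mul_left hc, ← mul_assoc, add_sub_one_mul_right hd, ← mul_assoc,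
      mul_add_sub_one_left hc, mul_assoc, mul_assoc, mul_add_sub_one_right hd]
  rw [h1, cfc_comp' Real.sqrt (fun x => x ^ 2) (c + d - 1), cfc_pow_id (R := ℝ) (c + d - 1) 2]
  exact h2.cfc_real _

theorem swapSymm_conj (hc : IsStarProjection c) (hd : IsStarProjection d) :
    swapSymm c d * c * swapSymm c d = c * swapKer c d + d * (1 - swapKer c d) := by
  set J := swapSymm c d
  set n := swapKer c d
  set M := cfc (fun x : ℝ => |x|) (c + d - 1)
  have hS := isSelfAdjoint_add_sub_one hc hd
  have hJ : J * J = 1 := swapSymm_mul_self c d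
  have hJM : J * M = c + d - 1 := swapSymm_mul_abs hc hd
  have hMc : M * c = c * M := (commute_abs_left hc hd).eq
  have hMJ : M * J = c + d - 1 := by
    have := congrArg star hJM
    rwa [star_mul, hS.star_eq, (isSelfAdjoint_swapSymm c d).star_eq,
      show star M = M from (cfc_predicate (R := ℝ) (p := IsSelfAdjoint) _ _ : IsSelfAdjoint M)] at this
  -- With S = c + d - 1 = J M = M J and M commuting with `c`, the product is (S c - d S) J, and S c
  -- = d c = d S. So J c = d J off the kernel of S.
  have h1 : (J * c - d * J) * (c + d - 1) = 0 := by
    rw [← hMJ, ← mul_assoc, sub_mul, mul_assoc J c M, ← hMc, ← mul_assoc, hJM, mul_assoc d J M, hJM,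
      add_sub_one_mul_left hc, mul_add_sub_one_right hd, sub_self, zero_mul]
  have h2 : (J * c - d * J) * (1 - n) = 0 := by
    have := mul_kerProj_of_mul_eq_zero hS h1
    rw [mul_sub, mul_one, show (J * c - d * J) * n = _ from this, sub_self]
  have h3 : J * n = n := swapSymm_mul_swapKer hc hd
  have h4 : n * J = n := swapKer_mul_swapSymm hc hd
  have h5 : c * n = n * c := (commute_swapKer_left hc hd).eq
  have e : J * c * J = J * c * J * n + J * c * J * (1 - n) := by noncomm_ring
  have e1 : J * c * J * n = c * n := by
    rw [mul_assoc, h3, mul_assoc, h5, ← mul_assoc, h3]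
  have e2 : J * c * J * (1 - n) = d * (1 - n) := by
    have h6 : J * (1 - n) = (1 - n) * J := by rw [mul_sub, sub_mul, h3, h4, mul_one, one_mul]
    have h7 : J * c * (1 - n) = d * J * (1 - n) := by rwa [sub_mul, sub_eq_zero] at h2
    rw [mul_assoc, h6, ← mul_assoc, h7, mul_assoc d J, h6, mul_assoc, mul_assoc, hJ, mul_one]
  rw [e, e1, e2]

end TwoProjections

/-! ### Unitaries cut down by a commuting projection and completed by the identity -/

section CornerUnitary

variable {R : Type*} [Ring R] [StarRing R] {V n x : R}

theorem conj_corner (hn : IsStarProjection n) (hV : Commute V n) (hx : Commute x n) :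
    (V * (1 - n) + n) * x * star (V * (1 - n) + n) = V * x * star V * (1 - n) + x * n := by
  have h0 := hn.isIdempotentElem.eq
  have hs : Commute (star V) n := by
    have := congrArg star hV.eq
    rw [star_mul, star_mul, hn.isSelfAdjoint.star_eq] at this
    exact this.symm
  have hq : (1 - n) * (1 - n) = 1 - n := hn.one_sub.isIdempotentElem.eq
  have hqn : (1 - n) * n = 0 := by rw [sub_mul, one_mul, h0, sub_self]
  have hxq : Commute x (1 - n) := (Commute.one_right x).sub_right hx
  have hsq : Commute (star V) (1 - n) := (Commute.one_right _).sub_right hs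
  have hnq : n * (1 - n) = 0 := by rw [mul_sub, mul_one, h0, sub_self]
  rw [star_add, star_mul, hn.isSelfAdjoint.star_eq, hn.one_sub.isSelfAdjoint.star_eq]
  have e1 : V * (1 - n) * x * ((1 - n) * star V) = V * x * star V * (1 - n) := by
    rw [mul_assoc V, ← hxq.eq, mul_assoc V, mul_assoc x, ← mul_assoc (1 - n) (1 - n), hq, ← hsq.eq]
    simp only [mul_assoc]
  have e2 : V * (1 - n) * x * n = 0 := by
    rw [mul_assoc _ x, hx.eq, ← mul_assoc, mul_assoc V, hqn, mul_zero, zero_mul]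
  have e3 : n * x * ((1 - n) * star V) = 0 := by
    rw [mul_assoc, ← mul_assoc x, hxq.eq, mul_assoc, ← mul_assoc, hnq, zero_mul]
  have e4 : n * x * n = x * n := by rw [← hx.eq, mul_assoc, h0]
  rw [add_mul, add_mul, mul_add, mul_add, e1, e2, e3, e4]
  abel

theorem corner_mul_star (hn : IsStarProjection n) (hV : Commute V n) (h1 : V * star V = 1) :
    (V * (1 - n) + n) * star (V * (1 - n) + n) = 1 := by
  have := conj_corner hn hV (Commute.one_left n)
  rw [mul_one, mul_one, h1, one_mul, one_mul] at this
  rw [this]; abel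

theorem star_mul_corner (hn : IsStarProjection n) (hV : Commute V n) (h1 : star V * V = 1) :
    star (V * (1 - n) + n) * (V * (1 - n) + n) = 1 := by
  have hs : Commute (star V) n := by
    have := congrArg star hV.eq
    rw [star_mul, star_mul, hn.isSelfAdjoint.star_eq] at this
    exact this.symm
  have h2 := corner_mul_star (V := star V) hn hs (by rwa [star_star])
  have h3 : star (V * (1 - n) + n) = star V * (1 - n) + n := by
    rw [star_add, star_mul, hn.isSelfAdjoint.star_eq, hn.one_sub.isSelfAdjoint.star_eq,
      ((Commute.one_right _).sub_right hs).eq]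
  have h4 : V * (1 - n) + n = star (star V * (1 - n) + n) := by rw [← h3, star_star]
  rw [h3]
  conv_lhs => rw [h4]
  rw [h4] at *
  simpa using h2

end CornerUnitary

/-! ### The unitary that carries one projection to another off the kernel -/

section SwapUnitary

variable {c d : H →L[ℂ] H}

/-- A unitary that conjugates `c` to `d` up to the kernel of `c + d - 1`. -/
def swapUnitary (c d : H →L[ℂ] H) : H →L[ℂ] H :=
  swapSymm c d * (2 * c - 1) * (1 - swapKer c d) + swapKer c d

theorem isSelfAdjoint_two_mul_sub_one {p : H →L[ℂ] H} (hp : IsStarProjection p) :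
    IsSelfAdjoint (2 * p - 1) := by
  rw [two_mul]
  exact (hp.isSelfAdjoint.add hp.isSelfAdjoint).sub (IsSelfAdjoint.one _)

theorem swap_mul_star (hc : IsStarProjection c) :
    swapSymm c d * (2 * c - 1) * star (swapSymm c d * (2 * c - 1)) = 1 := by
  rw [star_mul, (isSelfAdjoint_swapSymm c d).star_eq, (isSelfAdjoint_two_mul_sub_one hc).star_eq,
    mul_assoc, ← mul_assoc (2 * c - 1), two_mul_sub_one_sq hc, one_mul, swapSymm_mul_self]

theorem star_mul_swap (hc : IsStarProjection c) :
    star (swapSymm c d * (2 * c - 1)) * (swapSymm c d * (2 * c - 1)) = 1 := by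
  rw [star_mul, (isSelfAdjoint_swapSymm c d).star_eq, (isSelfAdjoint_two_mul_sub_one hc).star_eq,
    mul_assoc, ← mul_assoc (swapSymm c d), swapSymm_mul_self, one_mul, two_mul_sub_one_sq hc]

theorem commute_swapSymm_swapKer (hc : IsStarProjection c) (hd : IsStarProjection d) :
    Commute (swapSymm c d) (swapKer c d) :=
  (swapSymm_mul_swapKer hc hd).trans (swapKer_mul_swapSymm hc hd).symm

theorem commute_swap_swapKer (hc : IsStarProjection c) (hd : IsStarProjection d) :
    Commute (swapSymm c d * (2 * c - 1)) (swapKer c d) := by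
  have h := commute_swapKer_left hc hd
  refine (commute_swapSymm_swapKer hc hd).mul_left (Commute.sub_left ?_ (Commute.one_left _))
  rw [two_mul]; exact h.add_left h

theorem swapUnitary_mul_star (hc : IsStarProjection c) (hd : IsStarProjection d) :
    swapUnitary c d * star (swapUnitary c d) = 1 :=
  corner_mul_star (isStarProjection_swapKer c d) (commute_swap_swapKer hc hd) (swap_mul_star hc)

theorem star_mul_swapUnitary (hc : IsStarProjection c) (hd : IsStarProjection d) :
    star (swapUnitary c d) * swapUnitary c d = 1 :=
  star_mul_corner (isStarProjection_swapKer c d) (commute_swap_swapKer hc hd) (star_mul_swap hc)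

theorem swap_conj (hc : IsStarProjection c) (hd : IsStarProjection d) :
    swapSymm c d * (2 * c - 1) * c * star (swapSymm c d * (2 * c - 1))
      = c * swapKer c d + d * (1 - swapKer c d) := by
  have h1 : (2 * c - 1) * c = c := by
    rw [sub_mul, mul_assoc, hc.isIdempotentElem.eq, two_mul, one_mul, add_sub_cancel_right]
  have h2 : c * (2 * c - 1) = c := by
    rw [mul_sub, two_mul, mul_add, hc.isIdempotentElem.eq, mul_one, add_sub_cancel_right]
  rw [star_mul, (isSelfAdjoint_swapSymm c d).star_eq, (isSelfAdjoint_two_mul_sub_one hc).star_eq,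
    ← swapSymm_conj hc hd]
  rw [mul_assoc _ _ c, h1, ← mul_assoc, mul_assoc _ c, h2]

theorem swapUnitary_conj (hc : IsStarProjection c) (hd : IsStarProjection d) :
    swapUnitary c d * c * star (swapUnitary c d)
      = c * swapKer c d + d * (1 - swapKer c d) := by
  have hn := isStarProjection_swapKer c d
  have h := conj_corner hn (commute_swap_swapKer hc hd) (commute_swapKer_left hc hd)
  rw [swapUnitary, h, swap_conj hc hd, add_mul, mul_assoc, mul_assoc, hn.mul_one_sub_self,
    hn.one_sub.isIdempotentElem.eq, mul_zero, zero_add, add_comm]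

/-- For the symmetry J = 2χ - 1, J(2c - 1) - 1 = J(2c - 1 - J) = 2J(c - χ). The deviation from 1 is
thus a combination of two projections, whose traces can be estimated. -/
theorem swapUnitary_sub_one (c d : H →L[ℂ] H) :
    swapUnitary c d - 1 = 2 * (swapSymm c d *
      (c * (1 - swapKer c d) - spectralProjGE (c + d - 1) 0 * (1 - swapKer c d))) := by
  have h1 : swapSymm c d * (2 * c - 1 - swapSymm c d) = swapSymm c d * (2 * c - 1) - 1 := by
    rw [mul_sub, swapSymm_mul_self]
  have h2 : swapUnitary c d - 1 = (swapSymm c d * (2 * c - 1) - 1) * (1 - swapKer c d) := by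
    rw [swapUnitary, sub_mul _ 1, one_mul]; abel
  rw [h2, ← h1, ← sub_mul]
  conv_lhs => enter [1, 2]; rw [swapSymm]
  noncomm_ring

theorem swapSymm_mem {𝒜 : VonNeumannAlgebra H} (hc : c ∈ 𝒜) (hd : d ∈ 𝒜) : swapSymm c d ∈ 𝒜 := by
  have := spectralProjGE_mem (sub_mem (add_mem hc hd) (one_mem 𝒜)) 0
  rw [swapSymm, two_mul]
  exact sub_mem (add_mem this this) (one_mem 𝒜)

theorem swapKer_mem {𝒜 : VonNeumannAlgebra H} (hc : c ∈ 𝒜) (hd : d ∈ 𝒜) : swapKer c d ∈ 𝒜 :=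
  kerProj_mem (sub_mem (add_mem hc hd) (one_mem 𝒜))

theorem two_mul_sub_one_mem {𝒜 : VonNeumannAlgebra H} (hc : c ∈ 𝒜) : 2 * c - 1 ∈ 𝒜 := by
  rw [two_mul]
  exact sub_mem (add_mem hc hc) (one_mem 𝒜)

theorem swapUnitary_mem {𝒜 : VonNeumannAlgebra H} (hc : c ∈ 𝒜) (hd : d ∈ 𝒜) :
    swapUnitary c d ∈ 𝒜 :=
  add_mem (mul_mem (mul_mem (swapSymm_mem hc hd) (two_mul_sub_one_mem hc))
    (sub_mem (one_mem 𝒜) (swapKer_mem hc hd))) (swapKer_mem hc hd)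

/-- On a vector orthogonal to both projections, the symmetry and 2c - 1 are both -1, and the signs
cancel. Successive swaps therefore do not disturb the outcomes that are already settled. -/
theorem swapUnitary_mul_of_orthogonal (hc : IsStarProjection c) (hd : IsStarProjection d)
    {b : H →L[ℂ] H} (hcb : c * b = 0) (hdb : d * b = 0) :
    swapUnitary c d * b = b := by
  have hS := isSelfAdjoint_add_sub_one hc hd
  have hSb : (c + d - 1) * b = -b := by rw [sub_mul, add_mul, hcb, hdb]; simp
  have hnb : swapKer c d * b = 0 := by
    have := congrArg (fun x => x * b) (kerProj_mul_self hS)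
    rw [mul_assoc, hSb, zero_mul, mul_neg, neg_eq_zero] at this
    exact this
  set χ := spectralProjGE (c + d - 1) 0 with hχ
  have hχp : IsStarProjection χ := isStarProjection_spectralProjGE _ _
  have hχb : χ * b = 0 := by
    have h := spectralProjGE_mul_sub hS 0
    rw [map_zero, sub_zero] at h
    -- Conjugating χ(c + d - 1) ≥ 0 by `b` gives -(χb)*(χb) ≥ 0, which forces χb = 0.
    have hpos : 0 ≤ cfc (fun x : ℝ => max (x - 0) 0) (c + d - 1) :=
      cfc_nonneg fun x _ => le_max_right _ _
    rw [← h] at hpos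
    have h1 := star_left_conjugate_nonneg hpos b
    have h2 : star b * (χ * (c + d - 1)) * b = - (star (χ * b) * (χ * b)) := by
      rw [mul_assoc, mul_assoc, hSb, star_mul, hχp.isSelfAdjoint.star_eq, mul_assoc (star b),
        ← mul_assoc χ χ, hχp.isIdempotentElem.eq]
      simp
    rw [← hχ, h2, neg_nonneg] at h1
    exact CStarRing.star_mul_self_eq_zero_iff _ |>.1 (le_antisymm h1 (star_mul_self_nonneg _))
  have hJb : swapSymm c d * b = -b := by
    rw [swapSymm, sub_mul, mul_assoc, ← hχ, hχb]; simp
  rw [swapUnitary, add_mul, mul_assoc, sub_mul 1, hnb, one_mul, sub_zero, mul_assoc, sub_mul,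
    mul_assoc, hcb, add_zero]
  simp [hJb]

end SwapUnitary

/-! ### The real part of a trace -/

/-- The real part of the vector functional. -/
def reTr (Ω : H) (a : H →L[ℂ] H) : ℝ := (vectorState Ω a).re

/-- The vector functional is a trace on the algebra. -/
def IsTracialVector (𝒜 : VonNeumannAlgebra H) (Ω : H) : Prop :=
  ∀ a ∈ 𝒜, ∀ b ∈ 𝒜, vectorState Ω (a * b) = vectorState Ω (b * a)

variable {Ω : H}

theorem reTr_eq (Ω : H) (a : H →L[ℂ] H) : reTr Ω a = (inner ℂ Ω (a Ω)).re := rfl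

theorem reTr_add (a b : H →L[ℂ] H) : reTr Ω (a + b) = reTr Ω a + reTr Ω b := by
  simp [reTr_eq]

theorem reTr_sub (a b : H →L[ℂ] H) : reTr Ω (a - b) = reTr Ω a - reTr Ω b := by
  simp [reTr_eq]

theorem reTr_neg (a : H →L[ℂ] H) : reTr Ω (-a) = -reTr Ω a := by
  simp [reTr_eq]

theorem reTr_zero : reTr Ω (0 : H →L[ℂ] H) = 0 := by simp [reTr_eq]

theorem reTr_sum {ι : Type*} (s : Finset ι) (f : ι → H →L[ℂ] H) :
    reTr Ω (∑ i ∈ s, f i) = ∑ i ∈ s, reTr Ω (f i) := by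
  simp [reTr_eq, sum_apply]

theorem reTr_star_mul (a b : H →L[ℂ] H) : reTr Ω (star a * b) = (inner ℂ (a Ω) (b Ω)).re := by
  rw [reTr_eq, mul_apply_eq_comp, ContinuousLinearMap.star_eq_adjoint,
    ContinuousLinearMap.adjoint_inner_right]

theorem reTr_star_mul_self (a : H →L[ℂ] H) : reTr Ω (star a * a) = ‖a Ω‖ ^ 2 := by
  rw [reTr_star_mul, inner_self_eq_norm_sq_to_K]
  norm_cast

theorem reTr_proj {p : H →L[ℂ] H} (hp : IsStarProjection p) : reTr Ω p = ‖p Ω‖ ^ 2 := by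
  rw [← reTr_star_mul_self, hp.isSelfAdjoint.star_eq, hp.isIdempotentElem.eq]

theorem reTr_nonneg {a : H →L[ℂ] H} (ha : 0 ≤ a) : 0 ≤ reTr Ω a :=
  ((ContinuousLinearMap.nonneg_iff_isPositive a).1 ha).re_inner_nonneg_right Ω

theorem reTr_mono {a b : H →L[ℂ] H} (h : a ≤ b) : reTr Ω a ≤ reTr Ω b := by
  have := reTr_nonneg (Ω := Ω) (sub_nonneg.2 h)
  rwa [reTr_sub, sub_nonneg] at this

theorem twoNorm_sq (a : H →L[ℂ] H) : twoNorm Ω a ^ 2 = ‖a Ω‖ ^ 2 := by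
  have := reTr_star_mul_self (Ω := Ω) a
  rw [reTr] at this
  rw [twoNorm, this, Real.sqrt_sq (norm_nonneg _)]

section Trace

variable {𝒜 : VonNeumannAlgebra H} (htr : IsTracialVector 𝒜 Ω)
include htr

theorem reTr_comm {a b : H →L[ℂ] H} (ha : a ∈ 𝒜) (hb : b ∈ 𝒜) :
    reTr Ω (a * b) = reTr Ω (b * a) := by
  rw [reTr, reTr, htr a ha b hb]

theorem abs_reTr_proj_mul_le {p Y : H →L[ℂ] H} (hp : IsStarProjection p) (hpm : p ∈ 𝒜)
    (hY : Y ∈ 𝒜) : |reTr Ω (p * Y)| ≤ ‖Y‖ * reTr Ω p := by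
  have h1 : reTr Ω (p * Y) = reTr Ω (star p * (Y * p)) := by
    rw [hp.isSelfAdjoint.star_eq, ← mul_assoc, reTr_comm htr (mul_mem hpm hY) hpm, ← mul_assoc,
      hp.isIdempotentElem.eq]
  rw [h1, reTr_star_mul, mul_apply_eq_comp, reTr_proj hp]
  calc _ ≤ ‖inner ℂ (p Ω) (Y (p Ω))‖ := Complex.abs_re_le_norm _
    _ ≤ ‖p Ω‖ * ‖Y (p Ω)‖ := norm_inner_le_norm _ _
    _ ≤ ‖p Ω‖ * (‖Y‖ * ‖p Ω‖) := by gcongr; exact Y.le_opNorm _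
    _ = _ := by ring

theorem norm_apply_star {c : H →L[ℂ] H} (hc : c ∈ 𝒜) : ‖(star c) Ω‖ = ‖c Ω‖ := by
  have h2 := reTr_star_mul_self (Ω := Ω) (star c)
  rw [star_star, reTr_comm htr hc (star_mem hc), reTr_star_mul_self] at h2
  exact ((sq_eq_sq₀ (norm_nonneg _) (norm_nonneg _)).1 h2).symm

/-- The trace makes the adjoint isometric on the orbit of `Ω`, so right multiplication obeys the
same bound as left multiplication. -/
theorem norm_mul_apply_le {a b : H →L[ℂ] H} (ha : a ∈ 𝒜) (hb : b ∈ 𝒜) :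
    ‖(a * b) Ω‖ ≤ ‖a Ω‖ * ‖b‖ := by
  rw [← norm_apply_star htr (mul_mem ha hb), star_mul, mul_apply_eq_comp, ← norm_apply_star htr ha,
    mul_comm, ← norm_star b]
  exact (star b).le_opNorm _

end Trace

variable {𝒜 : VonNeumannAlgebra H}

theorem norm_le_one_of_star_mul_eq_one {U : H →L[ℂ] H} (h : star U * U = 1) : ‖U‖ ≤ 1 := by
  have h2 := CStarRing.norm_star_mul_self (x := U)
  rw [h] at h2
  have h3 : ‖(1 : H →L[ℂ] H)‖ ≤ 1 := ContinuousLinearMap.norm_id_le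
  nlinarith [norm_nonneg U]

theorem norm_swapSymm_le (c d : H →L[ℂ] H) : ‖swapSymm c d‖ ≤ 1 :=
  norm_le_one_of_star_mul_eq_one
    (by rw [(isSelfAdjoint_swapSymm c d).star_eq, swapSymm_mul_self])

theorem isStarProjection_mul {p q : H →L[ℂ] H} (hp : IsStarProjection p) (hq : IsStarProjection q)
    (h : Commute p q) : IsStarProjection (p * q) :=
  ⟨hp.isIdempotentElem.mul_of_commute h hq.isIdempotentElem,
    (hp.isSelfAdjoint.commute_iff hq.isSelfAdjoint).1 h⟩

theorem norm_starProjection_le {p : H →L[ℂ] H} (hp : IsStarProjection p) : ‖p‖ ≤ 1 :=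
  hp.norm_le

theorem reTr_proj_nonneg {p : H →L[ℂ] H} (hp : IsStarProjection p) : 0 ≤ reTr Ω p := by
  rw [reTr_proj hp]; positivity

theorem reTr_proj_mul_le (htr : IsTracialVector 𝒜 Ω) {p q : H →L[ℂ] H} (hp : IsStarProjection p)
    (hpm : p ∈ 𝒜) (hq : IsStarProjection q) (hqm : q ∈ 𝒜) : reTr Ω (p * q) ≤ reTr Ω p := by
  have h1 := abs_reTr_proj_mul_le htr hp hpm hqm
  have h2 := norm_starProjection_le hq
  nlinarith [le_abs_self (reTr Ω (p * q)), reTr_proj_nonneg (Ω := Ω) hp]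

/-- The unitary `swapUnitary c d` is close to `1` in trace norm if `c` has small trace. -/
theorem abs_reTr_swapUnitary_sub_one_le (htr : IsTracialVector 𝒜 Ω) {c d Y : H →L[ℂ] H}
    (hc : IsStarProjection c) (hd : IsStarProjection d) (hcm : c ∈ 𝒜) (hdm : d ∈ 𝒜)
    (hY : Y ∈ 𝒜) :
    |reTr Ω ((swapUnitary c d - 1) * Y)| ≤ 6 * ‖Y‖ * reTr Ω (c * (1 - swapKer c d)) := by
  have hS := isSelfAdjoint_add_sub_one hc hd
  have hU := swapUnitary_sub_one c d
  have hconj := swapSymm_conj hc hd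
  have hJ := swapSymm_mul_self c d
  have hJm : swapSymm c d ∈ 𝒜 := swapSymm_mem hcm hdm
  have hnm : swapKer c d ∈ 𝒜 := swapKer_mem hcm hdm
  have hn := isStarProjection_swapKer c d
  have hχm : spectralProjGE (c + d - 1) 0 ∈ 𝒜 :=
    spectralProjGE_mem (sub_mem (add_mem hcm hdm) (one_mem 𝒜)) 0
  have hχ := isStarProjection_spectralProjGE (c + d - 1) 0
  have hχn := spectralProjGE_mul_swapKer hc hd
  have hcn := commute_swapKer_left hc hd
  have hdn := commute_swapKer_right hc hd
  have hnS : swapKer c d * (c + d - 1) = 0 := kerProj_mul_self hS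
  have hχS := spectralProjGE_mul_sub hS 0
  rw [map_zero, sub_zero] at hχS
  have hpos : 0 ≤ cfc (fun x : ℝ => max (x - 0) 0) (c + d - 1) :=
    cfc_nonneg fun x _ => le_max_right _ _
  rw [← hχS] at hpos
  have hJ1 := norm_swapSymm_le c d
  set n := swapKer c d
  set χ := spectralProjGE (c + d - 1) 0
  set J := swapSymm c d
  have hqm : 1 - n ∈ 𝒜 := sub_mem (one_mem 𝒜) hnm
  have hnχ : n * χ = n := by
    have := congrArg star hχn
    rwa [star_mul, hn.isSelfAdjoint.star_eq, hχ.isSelfAdjoint.star_eq] at this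
  have hc' : IsStarProjection (c * (1 - n)) :=
    isStarProjection_mul hc hn.one_sub ((Commute.one_right c).sub_right hcn)
  have hd' : IsStarProjection (d * (1 - n)) :=
    isStarProjection_mul hd hn.one_sub ((Commute.one_right d).sub_right hdn)
  have hg : IsStarProjection (χ * (1 - n)) :=
    isStarProjection_mul hχ hn.one_sub ((Commute.one_right χ).sub_right (hχn.trans hnχ.symm))
  have hgm : χ * (1 - n) ∈ 𝒜 := mul_mem hχm hqm
  have hc'm : c * (1 - n) ∈ 𝒜 := mul_mem hcm hqm
  have hd'm : d * (1 - n) ∈ 𝒜 := mul_mem hdm hqm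
  -- The parts of `c` and `d` off the kernel are unitarily equivalent.
  have htrd : reTr Ω (d * (1 - n)) = reTr Ω (c * (1 - n)) := by
    have h1 : reTr Ω (J * c * J) = reTr Ω c := by
      rw [reTr_comm htr (mul_mem hJm hcm) hJm, ← mul_assoc, hJ, one_mul]
    rw [hconj, reTr_add] at h1
    rw [mul_sub c, mul_one, reTr_sub]; linarith
  have hgq : ∀ x, Commute x n → χ * (1 - n) * x = χ * (1 - n) * (x * (1 - n)) := fun x hx => by
    rw [((Commute.one_right x).sub_right hx).eq, ← mul_assoc (χ * (1 - n)),
      mul_assoc χ (1 - n) (1 - n), hn.one_sub.isIdempotentElem.eq]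
  -- Where c + d ≥ 1, the trace of the spectral subspace is at most the traces of `c` and `d` on it
  -- together. With the factor 2 of `swapUnitary_sub_one`, the constant becomes 2(1 + 2) = 6.
  have hgtr : reTr Ω (χ * (1 - n)) ≤ 2 * reTr Ω (c * (1 - n)) := by
    have h1 : 0 ≤ reTr Ω (χ * (1 - n) * (c + d - 1)) := by
      have : χ * (1 - n) * (c + d - 1) = χ * (c + d - 1) := by
        rw [mul_assoc, sub_mul 1, hnS, one_mul, sub_zero]
      rw [this]; exact reTr_nonneg hpos
    rw [mul_sub, mul_one, mul_add, reTr_sub, reTr_add, hgq c hcn, hgq d hdn,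
      reTr_comm htr hgm hc'm, reTr_comm htr hgm hd'm] at h1
    have h2 := reTr_proj_mul_le htr hc' hc'm hg hgm
    have h3 := reTr_proj_mul_le htr hd' hd'm hg hgm
    linarith
  have hYJ : Y * J ∈ 𝒜 := mul_mem hY hJm
  have hYJn : ‖Y * J‖ ≤ ‖Y‖ := (norm_mul_le _ _).trans (mul_le_of_le_one_right (norm_nonneg _) hJ1)
  have e1 : reTr Ω ((swapUnitary c d - 1) * Y)
      = 2 * (reTr Ω (c * (1 - n) * (Y * J)) - reTr Ω (χ * (1 - n) * (Y * J))) := by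
    rw [hU, two_mul, add_mul, reTr_add, mul_assoc J,
      reTr_comm htr hJm (mul_mem (sub_mem hc'm hgm) hY), mul_assoc _ Y, sub_mul, reTr_sub]
    ring
  have b1 := abs_reTr_proj_mul_le htr hc' hc'm hYJ
  have b2 := abs_reTr_proj_mul_le htr hg hgm hYJ
  have p1 := reTr_proj_nonneg (Ω := Ω) hc'
  have p2 := reTr_proj_nonneg (Ω := Ω) hg
  have b3 := mul_le_mul_of_nonneg_right hYJn p1
  have b4 := mul_le_mul_of_nonneg_right hYJn p2
  have b5 := mul_le_mul_of_nonneg_left hgtr (norm_nonneg Y)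
  rw [e1, abs_mul, abs_two]
  have := abs_sub (reTr Ω (c * (1 - n) * (Y * J))) (reTr Ω (χ * (1 - n) * (Y * J)))
  linarith

/-! ### Moving a projection of small trace into the commutant of a PVM -/

/-- A finite orthogonal family of projections in `𝒜` with sum one. -/
structure IsPVMIn {A : Type v} [Fintype A] (𝒜 : VonNeumannAlgebra H) (e : A → H →L[ℂ] H) :
    Prop where
  mem : ∀ a, e a ∈ 𝒜
  proj : ∀ a, IsStarProjection (e a)
  orth : ∀ a b, a ≠ b → e a * e b = 0
  sum_eq : ∑ a, e a = 1

/-- The outcomes are treated one at a time. A swap with e_a moves k(1 - n) onto a part of e_a; the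
rest k n is orthogonal to e_a and is passed on to the other outcomes. The estimate is linear in the
trace and allows an arbitrary factor `Y`, so the costs add up to τ(k(1 - n)) + τ(k n) = τ(k). Adding
two-norms would lose a factor that depends on the number of outcomes. -/
theorem exists_unitary_conj_commute_aux {A : Type v} [Fintype A] [DecidableEq A]
    (htr : IsTracialVector 𝒜 Ω) {e : A → H →L[ℂ] H} (he : IsPVMIn 𝒜 e) (s : Finset A) :
    ∀ k : H →L[ℂ] H, IsStarProjection k → k ∈ 𝒜 → (∀ b ∉ s, k * e b = 0) →
      ∃ U ∈ 𝒜, U * star U = 1 ∧ star U * U = 1 ∧ (∀ a, Commute (e a) (U * k * star U)) ∧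
        (∀ b ∉ s, U * e b = e b) ∧
        ∀ Y ∈ 𝒜, |reTr Ω ((U - 1) * Y)| ≤ 6 * ‖Y‖ * reTr Ω k := by
  induction s using Finset.induction_on with
  | empty =>
    intro k hk hkm hke
    have hk0 : k = 0 := by
      rw [← mul_one k, ← he.sum_eq, Finset.mul_sum]
      exact Finset.sum_eq_zero fun b _ => hke b (Finset.notMem_empty b)
    refine ⟨1, one_mem 𝒜, by simp, by simp, fun a => ?_, by simp, fun Y _ => ?_⟩
    · rw [hk0]; simp
    · rw [hk0]; simp [reTr_zero]
  | insert a s ha ih =>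
    intro k hk hkm hke
    have hd := he.proj a
    have hdm := he.mem a
    have hn := isStarProjection_swapKer k (e a)
    have hnm : swapKer k (e a) ∈ 𝒜 := swapKer_mem hkm hdm
    have hkn := commute_swapKer_left hk hd
    have hdn := commute_swapKer_right hk hd
    have hker := mul_swapKer k (e a)
    have hconj := swapUnitary_conj hk hd
    have hUU := swapUnitary_mul_star hk hd
    have hUU' := star_mul_swapUnitary hk hd
    have hUm : swapUnitary k (e a) ∈ 𝒜 := swapUnitary_mem hkm hdm
    have hfix : ∀ b ∉ insert a s, swapUnitary k (e a) * e b = e b := fun b hb =>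
      swapUnitary_mul_of_orthogonal hk hd (hke b hb)
        (he.orth a b fun h => hb (h ▸ Finset.mem_insert_self a s))
    have htr1 := fun Y (hY : Y ∈ 𝒜) => abs_reTr_swapUnitary_sub_one_le htr hk hd hkm hdm hY
    set n := swapKer k (e a)
    set U₁ := swapUnitary k (e a)
    have hr : IsStarProjection (k * n) := isStarProjection_mul hk hn hkn
    -- On n the projection e_a equals 1 - k.
    have hea : e a * (k * n) = 0 := by
      rw [hkn.eq, ← mul_assoc, hker, mul_assoc, ← hkn.eq, ← mul_assoc, sub_mul, one_mul,
        hk.isIdempotentElem.eq, sub_self, zero_mul]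
    have hea' : k * n * e a = 0 := by
      have := congrArg star hea
      rwa [star_mul, hr.isSelfAdjoint.star_eq, hd.isSelfAdjoint.star_eq, star_zero] at this
    have hre : ∀ b ∉ s, k * n * e b = 0 := fun b hb => by
      by_cases hba : b = a
      · rw [hba, hea']
      · rw [hkn.eq, mul_assoc, hke b (by simp [hba, hb]), mul_zero]
    obtain ⟨U₂, hU₂m, h1, h2, h3, h4, h5⟩ := ih (k * n) hr (mul_mem hkm hnm) hre
    -- The later unitary fixes e_a, since `a` is not among the remaining outcomes.
    have hU₂a : U₂ * (e a * (1 - n)) * star U₂ = e a * (1 - n) := by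
      have c1 : U₂ * (e a * (1 - n)) = e a * (1 - n) := by rw [← mul_assoc, h4 a ha]
      have c2 : IsStarProjection (e a * (1 - n)) :=
        isStarProjection_mul hd hn.one_sub ((Commute.one_right _).sub_right hdn)
      rw [c1]
      have := congrArg star c1
      rwa [star_mul, c2.isSelfAdjoint.star_eq] at this
    refine ⟨U₂ * U₁, mul_mem hU₂m hUm, ?_, ?_, fun b => ?_, fun b hb => ?_, fun Y hY => ?_⟩
    · rw [star_mul, mul_assoc, ← mul_assoc U₁, hUU, one_mul, h1]
    · rw [star_mul, mul_assoc, ← mul_assoc _ U₂, h2, one_mul, hUU']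
    · have : U₂ * U₁ * k * star (U₂ * U₁) = U₂ * (k * n) * star U₂ + e a * (1 - n) := by
        rw [star_mul]
        calc _ = U₂ * (U₁ * k * star U₁) * star U₂ := by simp only [mul_assoc]
          _ = _ := by rw [hconj, mul_add, add_mul, hU₂a]
      rw [this]
      refine (h3 b).add_right ?_
      by_cases hba : b = a
      · rw [hba]
        exact (Commute.refl _).mul_right ((Commute.one_right _).sub_right hdn)
      · have z1 : e b * (e a * (1 - n)) = 0 := by rw [← mul_assoc, he.orth b a hba, zero_mul]
        have z2 : e a * (1 - n) * e b = 0 := by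
          rw [((Commute.one_right (e a)).sub_right hdn).eq, mul_assoc,
            he.orth a b (Ne.symm hba), mul_zero]
        exact z1.trans z2.symm
    · rw [mul_assoc, hfix b hb, h4 b fun h => hb (Finset.mem_insert_of_mem h)]
    · have t1 := htr1 Y hY
      have t2 := h5 (U₁ * Y) (mul_mem hUm hY)
      have e1 : (U₂ * U₁ - 1) * Y = (U₂ - 1) * (U₁ * Y) + (U₁ - 1) * Y := by
        noncomm_ring
      have hU₁n : ‖U₁‖ ≤ 1 := norm_le_one_of_star_mul_eq_one hUU'
      have t3 : ‖U₁ * Y‖ ≤ ‖Y‖ :=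
        (norm_mul_le _ _).trans (mul_le_of_le_one_left (norm_nonneg _) hU₁n)
      have t4 := mul_le_mul_of_nonneg_right t3 (reTr_proj_nonneg (Ω := Ω) hr)
      rw [mul_sub, mul_one, reTr_sub] at t1
      rw [e1, reTr_add]
      have := abs_add_le (reTr Ω ((U₂ - 1) * (U₁ * Y))) (reTr Ω ((U₁ - 1) * Y))
      linarith

theorem exists_unitary_conj_commute {A : Type v} [Fintype A]
    (htr : IsTracialVector 𝒜 Ω) {e : A → H →L[ℂ] H} (he : IsPVMIn 𝒜 e) {k : H →L[ℂ] H}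
    (hk : IsStarProjection k) (hkm : k ∈ 𝒜) :
    ∃ U ∈ 𝒜, U * star U = 1 ∧ star U * U = 1 ∧ (∀ a, Commute (e a) (U * k * star U)) ∧
      ∀ Y ∈ 𝒜, |reTr Ω ((U - 1) * Y)| ≤ 6 * ‖Y‖ * reTr Ω k := by
  classical
  obtain ⟨U, h0, h1, h2, h3, -, h4⟩ :=
    exists_unitary_conj_commute_aux htr he Finset.univ k hk hkm fun b hb =>
      absurd (Finset.mem_univ b) hb
  exact ⟨U, h0, h1, h2, h3, h4⟩

/-- The elements of `𝒜` that commute with the self-adjoint operator `p`. -/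
def relativeCommutant (𝒜 : VonNeumannAlgebra H) (p : H →L[ℂ] H) : VonNeumannAlgebra H where
  toStarSubalgebra := StarSubalgebra.centralizer ℂ ((𝒜.commutant : Set (H →L[ℂ] H)) ∪ {p})
  centralizer_centralizer' := by
    change Set.centralizer (Set.centralizer (StarSubalgebra.centralizer ℂ
      ((𝒜.commutant : Set (H →L[ℂ] H)) ∪ {p}) : Set (H →L[ℂ] H)))
        = (StarSubalgebra.centralizer ℂ
      ((𝒜.commutant : Set (H →L[ℂ] H)) ∪ {p}) : Set (H →L[ℂ] H))
    simp

theorem mem_relativeCommutant {p x : H →L[ℂ] H} (hp : IsSelfAdjoint p) :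
    x ∈ relativeCommutant 𝒜 p ↔ x ∈ 𝒜 ∧ Commute x p := by
  have h : x ∈ relativeCommutant 𝒜 p ↔
      x ∈ StarSubalgebra.centralizer ℂ ((𝒜.commutant : Set (H →L[ℂ] H)) ∪ {p}) := Iff.rfl
  rw [h, StarSubalgebra.mem_centralizer_iff]
  constructor
  · intro h
    exact ⟨mem_of_commute fun y hy => (h y (Or.inl hy)).1, (h p (Or.inr rfl)).1.symm⟩
  · rintro ⟨h1, h2⟩ g (hg | hg)
    · exact ⟨commute_of_mem_commutant h1 hg, commute_of_mem_commutant h1 (star_mem hg)⟩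
    · rw [Set.mem_singleton_iff] at hg
      subst hg
      rw [hp.star_eq]
      exact ⟨h2.symm, h2.symm⟩

/-! ### Commutators with a PVM, and pinching -/

namespace IsPVMIn

variable {A : Type v} [Fintype A] {e : A → H →L[ℂ] H}

theorem sum_norm_sq (he : IsPVMIn 𝒜 e) (v : H) : ∑ a, ‖e a v‖ ^ 2 = ‖v‖ ^ 2 := by
  have h1 : ∀ a, ‖e a v‖ ^ 2 = reTr v (e a) := fun a => (reTr_proj (he.proj a)).symm
  simp_rw [h1]
  rw [← reTr_sum, he.sum_eq, reTr_proj (IsStarProjection.one _)]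
  simp

theorem sum_norm_sq_right (he : IsPVMIn 𝒜 e) (htr : IsTracialVector 𝒜 Ω) {x : H →L[ℂ] H}
    (hx : x ∈ 𝒜) : ∑ a, ‖(x * e a) Ω‖ ^ 2 = ‖x Ω‖ ^ 2 := by
  rw [← norm_apply_star htr hx, ← he.sum_norm_sq]
  refine Finset.sum_congr rfl fun a _ => ?_
  rw [← norm_apply_star htr (mul_mem hx (he.mem a)), star_mul, (he.proj a).isSelfAdjoint.star_eq,
    mul_apply_eq_comp]

theorem sum_commutator_le (he : IsPVMIn 𝒜 e) (htr : IsTracialVector 𝒜 Ω) {x : H →L[ℂ] H}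
    (hx : x ∈ 𝒜) : ∑ a, ‖(x * e a - e a * x) Ω‖ ^ 2 ≤ 4 * ‖x Ω‖ ^ 2 := by
  have h : ∀ a, ‖(x * e a - e a * x) Ω‖ ^ 2 ≤ 2 * (‖(x * e a) Ω‖ ^ 2 + ‖e a (x Ω)‖ ^ 2) :=
    fun a => by
      have h1 : ‖(x * e a - e a * x) Ω‖ ≤ ‖(x * e a) Ω‖ + ‖e a (x Ω)‖ := by
        rw [sub_apply, mul_apply_eq_comp (e a)]; exact norm_sub_le _ _
      have h2 := pow_le_pow_left₀ (norm_nonneg _) h1 2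
      nlinarith [sq_nonneg (‖(x * e a) Ω‖ - ‖e a (x Ω)‖)]
  refine (Finset.sum_le_sum fun a _ => h a).trans ?_
  rw [← Finset.mul_sum, Finset.sum_add_distrib, he.sum_norm_sq_right htr hx, he.sum_norm_sq]
  linarith

/-- The commutators of a PVM with a self-adjoint operator. -/
theorem sum_commutator_eq (he : IsPVMIn 𝒜 e) (htr : IsTracialVector 𝒜 Ω) {x : H →L[ℂ] H}
    (hx : x ∈ 𝒜) (hxs : IsSelfAdjoint x) : ∑ a, ‖(e a * x - x * e a) Ω‖ ^ 2
      = 2 * reTr Ω (x * x) - 2 * ∑ a, reTr Ω (x * e a * x * e a) := by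
  have h : ∀ a, ‖(e a * x - x * e a) Ω‖ ^ 2
      = ‖e a (x Ω)‖ ^ 2 + ‖(x * e a) Ω‖ ^ 2 - 2 * reTr Ω (x * e a * x * e a) := fun a => by
    have h1 : reTr Ω (x * e a * x * e a) = (inner ℂ ((e a * x) Ω) ((x * e a) Ω)).re := by
      rw [← reTr_star_mul, star_mul, hxs.star_eq, (he.proj a).isSelfAdjoint.star_eq,
        mul_assoc (x * e a)]
    have h2 := norm_sub_sq (𝕜 := ℂ) ((e a * x) Ω) ((x * e a) Ω)
    rw [sub_apply, h2, h1, mul_apply_eq_comp (e a) x]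
    simp only [RCLike.re_to_complex]
    ring
  simp_rw [h]
  rw [Finset.sum_sub_distrib, Finset.sum_add_distrib, he.sum_norm_sq, he.sum_norm_sq_right htr hx,
    ← Finset.mul_sum]
  have : reTr Ω (x * x) = ‖x Ω‖ ^ 2 := by rw [← reTr_star_mul_self, hxs.star_eq]
  rw [this]; ring

/-- The pinching of `x` by the PVM. -/
def pinch (e : A → H →L[ℂ] H) (x : H →L[ℂ] H) : H →L[ℂ] H := ∑ a, e a * x * e a

theorem mul_pinch [DecidableEq A] (he : IsPVMIn 𝒜 e) (x : H →L[ℂ] H) (b : A) :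
    e b * pinch e x = e b * x * e b := by
  rw [pinch, Finset.mul_sum, Finset.sum_eq_single b]
  · rw [← mul_assoc, ← mul_assoc, (he.proj b).isIdempotentElem.eq]
  · intro a _ hab
    rw [← mul_assoc, ← mul_assoc, he.orth b a (Ne.symm hab), zero_mul, zero_mul]
  · simp

theorem pinch_mul [DecidableEq A] (he : IsPVMIn 𝒜 e) (x : H →L[ℂ] H) (b : A) :
    pinch e x * e b = e b * x * e b := by
  rw [pinch, Finset.sum_mul, Finset.sum_eq_single b]
  · rw [mul_assoc, (he.proj b).isIdempotentElem.eq]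
  · intro a _ hab
    rw [mul_assoc, he.orth a b hab, mul_zero]
  · simp

theorem pinch_mem (he : IsPVMIn 𝒜 e) {x : H →L[ℂ] H} (hx : x ∈ 𝒜) : pinch e x ∈ 𝒜 :=
  sum_mem fun a _ => mul_mem (mul_mem (he.mem a) hx) (he.mem a)

theorem pinch_nonneg (he : IsPVMIn 𝒜 e) {x : H →L[ℂ] H} (hx : 0 ≤ x) : 0 ≤ pinch e x :=
  Finset.sum_nonneg fun a _ => by
    have := star_left_conjugate_nonneg hx (e a)
    rwa [(he.proj a).isSelfAdjoint.star_eq] at this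

theorem pinch_le_one (he : IsPVMIn 𝒜 e) {x : H →L[ℂ] H} (hx : x ≤ 1) : pinch e x ≤ 1 := by
  rw [← he.sum_eq]
  refine Finset.sum_le_sum fun a _ => ?_
  have := star_left_conjugate_le_conjugate hx (e a)
  rwa [(he.proj a).isSelfAdjoint.star_eq, mul_one, (he.proj a).isIdempotentElem.eq] at this

theorem reTr_pinch (he : IsPVMIn 𝒜 e) (htr : IsTracialVector 𝒜 Ω) {x : H →L[ℂ] H}
    (hx : x ∈ 𝒜) : reTr Ω (pinch e x) = reTr Ω x := by
  have h : ∀ a, reTr Ω (e a * x * e a) = reTr Ω (x * e a) := fun a => by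
    rw [reTr_comm htr (mul_mem (he.mem a) hx) (he.mem a), ← mul_assoc,
      (he.proj a).isIdempotentElem.eq, reTr_comm htr (he.mem a) hx]
  rw [pinch, reTr_sum]
  simp_rw [h]
  rw [← reTr_sum, ← Finset.mul_sum, he.sum_eq, mul_one]

/-- A projection is close to a projection that commutes with the PVM. -/
theorem exists_commuting_projection (he : IsPVMIn 𝒜 e) (htr : IsTracialVector 𝒜 Ω)
    {P : H →L[ℂ] H} (hP : IsStarProjection P) (hPm : P ∈ 𝒜) :
    ∃ p ∈ 𝒜, IsStarProjection p ∧ (∀ a, Commute (e a) p) ∧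
      ‖(P - p) Ω‖ ^ 2 ≤ 2 * ∑ a, ‖(e a * P - P * e a) Ω‖ ^ 2 := by
  classical
  set T := pinch e P with hT
  have hT0 : 0 ≤ T := he.pinch_nonneg hP.nonneg
  have hT1 : T ≤ 1 := he.pinch_le_one hP.le_one
  have hTs : IsSelfAdjoint T := IsSelfAdjoint.of_nonneg hT0
  have hTm : T ∈ 𝒜 := he.pinch_mem hPm
  have hTc : ∀ a, Commute (e a) T := fun a => (he.mul_pinch P a).trans (he.pinch_mul P a).symm
  -- Functions of the pinching commute with the PVM. Cutting at 1/2 rounds each spectral value in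
  -- [0, 1] to the nearer endpoint.
  set p := spectralProjGE T (1 / 2) with hp
  have hpp : IsStarProjection p := isStarProjection_spectralProjGE _ _
  have hpm : p ∈ 𝒜 := spectralProjGE_mem hTm _
  refine ⟨p, hpm, hpp, fun a => commute_spectralProjGE (hTc a)
    (by rw [(he.proj a).isSelfAdjoint.star_eq]; exact hTc a) _, ?_⟩
  have hTT : reTr Ω (T * T) = ∑ a, reTr Ω (P * e a * P * e a) := by
    conv_lhs => rw [hT]; enter [2, 2]; rw [pinch]
    rw [Finset.mul_sum, reTr_sum]
    refine Finset.sum_congr rfl fun a _ => ?_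
    rw [← mul_assoc, ← mul_assoc, he.pinch_mul, mul_assoc (e a * P), mul_assoc (e a * P),
      reTr_comm htr (mul_mem (he.mem a) hPm) (mul_mem (mul_mem (he.mem a) hPm) (he.mem a)),
      ← mul_assoc, mul_assoc (e a * P) (e a), (he.proj a).isIdempotentElem.eq, mul_assoc (e a * P),
      reTr_comm htr (mul_mem (he.mem a) hPm) (mul_mem (he.mem a) hPm), ← mul_assoc,
      mul_assoc, mul_assoc, reTr_comm htr (he.mem a) (mul_mem hPm (mul_mem (he.mem a) hPm))]
    simp only [mul_assoc]
  have hPT : reTr Ω (P * T) = ∑ a, reTr Ω (P * e a * P * e a) := by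
    rw [hT, pinch, Finset.mul_sum, reTr_sum]
    simp only [mul_assoc]
  have hPP : P * P = P := hP.isIdempotentElem.eq
  have hε := he.sum_commutator_eq htr hPm hP.isSelfAdjoint
  rw [hPP, ← hTT] at hε
  have hTP := he.reTr_pinch htr hPm
  -- The pinching is an orthogonal projection in the two-norm. By `hε` this equals half the sum of
  -- the squared commutators.
  have d1 : ‖(P - T) Ω‖ ^ 2 = reTr Ω P - reTr Ω (T * T) := by
    rw [← reTr_star_mul_self, star_sub, hP.isSelfAdjoint.star_eq, hTs.star_eq]
    have : (P - T) * (P - T) = P * P - P * T - T * P + T * T := by noncomm_ring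
    rw [this, reTr_add, reTr_sub, reTr_sub, reTr_comm htr hTm hPm, hPT, hPP, hTT]
    ring
  have hsub := spectralProjGE_mul_sub hTs (1 / 2)
  have hpT : Commute T p := commute_spectralProjGE (Commute.refl T)
    (by rw [hTs.star_eq]) _
  have hspec : ∀ x ∈ spectrum ℝ T, 0 ≤ x ∧ x ≤ 1 := by
    intro x hx
    refine ⟨spectrum_nonneg_of_nonneg hT0 hx, ?_⟩
    have h1 : T ≤ algebraMap ℝ (H →L[ℂ] H) 1 := by rwa [map_one]
    exact (le_algebraMap_iff_spectrum_le (a := T)).1 h1 x hx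
  have d2 : ‖(T - p) Ω‖ ^ 2 ≤ reTr Ω T - reTr Ω (T * T) := by
    -- Here (T - p)² = T² - 2p(T - 1/2), in which `p` occurs only through the continuous function (x
    -- - 1/2)⁺. What remains is that the squared distance from x to the nearer of 0 and 1 is at most
    -- x - x².
    have e1 : star (T - p) * (T - p) = cfc (fun x : ℝ => x * x - 2 * max (x - 1 / 2) 0) T := by
      rw [cfc_sub _ _ T (by fun_prop) (by fun_prop), cfc_const_mul 2 _ T (by fun_prop), ← hsub,
        cfc_mul _ _ T (by fun_prop) (by fun_prop), cfc_id' ℝ T, star_sub, hTs.star_eq,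
        hpp.isSelfAdjoint.star_eq]
      have : (T - p) * (T - p) = T * T - T * p - p * T + p * p := by noncomm_ring
      rw [this, hpT.eq, hpp.isIdempotentElem.eq, mul_sub, ← hp, smul_sub,
        ← Algebra.commutes, ← Algebra.smul_def, smul_smul]
      norm_num
      rw [two_smul]; abel
    have e2 : T - T * T = cfc (fun x : ℝ => x - x * x) T := by
      rw [cfc_sub _ _ T (by fun_prop) (by fun_prop),
        cfc_mul _ _ T (by fun_prop) (by fun_prop), cfc_id' ℝ T]
    rw [← reTr_star_mul_self, ← reTr_sub, e1, e2]
    refine reTr_mono (cfc_mono fun x hx => ?_)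
    obtain ⟨h0, h1⟩ := hspec x hx
    rcases le_total x (1 / 2) with h | h
    · rw [max_eq_right (by linarith)]; nlinarith
    · rw [max_eq_left (by linarith)]; nlinarith
  have d3 : ‖(P - p) Ω‖ ≤ ‖(P - T) Ω‖ + ‖(T - p) Ω‖ := by
    have : (P - p) Ω = (P - T) Ω + (T - p) Ω := by simp
    rw [this]; exact norm_add_le _ _
  have d4 := pow_le_pow_left₀ (norm_nonneg _) d3 2
  have := sq_nonneg (‖(P - T) Ω‖ - ‖(T - p) Ω‖)
  nlinarith

end IsPVMIn

/-! ### Two-norm estimates for a pair of nearby projections -/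

theorem norm_two_mul_sub_one_le {p : H →L[ℂ] H} (hp : IsStarProjection p) : ‖2 * p - 1‖ ≤ 1 :=
  norm_le_one_of_star_mul_eq_one
    (by rw [(isSelfAdjoint_two_mul_sub_one hp).star_eq, two_mul_sub_one_sq hp])

theorem norm_apply_le_of_norm_le_one {U : H →L[ℂ] H} (h : ‖U‖ ≤ 1) (v : H) : ‖U v‖ ≤ ‖v‖ :=
  (U.le_opNorm v).trans (mul_le_of_le_one_left (norm_nonneg v) h)

theorem norm_mul_apply_le_of_norm_le_one (htr : IsTracialVector 𝒜 Ω) {a U : H →L[ℂ] H}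
    (ha : a ∈ 𝒜) (hU : U ∈ 𝒜) (h : ‖U‖ ≤ 1) : ‖(a * U) Ω‖ ≤ ‖a Ω‖ :=
  (norm_mul_apply_le htr ha hU).trans (mul_le_of_le_one_right (norm_nonneg _) h)

theorem sub_sq_of_projections {c d : H →L[ℂ] H} (hc : IsStarProjection c)
    (hd : IsStarProjection d) : (c + d - 1) * (c + d - 1) = 1 - (c - d) * (c - d) := by
  have h1 := hc.isIdempotentElem.eq
  have h2 := hd.isIdempotentElem.eq
  have e1 : (c + d - 1) * (c + d - 1) = c * c + d * d + c * d + d * c - c - c - d - d + 1 := by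
    noncomm_ring
  have e2 : (c - d) * (c - d) = c * c + d * d - c * d - d * c := by noncomm_ring
  rw [e1, e2, h1, h2]; abel

theorem abs_le_one_of_mem_spectrum {c d : H →L[ℂ] H} (hc : IsStarProjection c)
    (hd : IsStarProjection d) {x : ℝ} (hx : x ∈ spectrum ℝ (c + d - 1)) : |x| ≤ 1 := by
  have hS := isSelfAdjoint_add_sub_one hc hd
  have h1 : c + d - 1 ≤ algebraMap ℝ (H →L[ℂ] H) 1 := by
    rw [map_one, ← sub_nonneg]
    have := add_nonneg hc.one_sub_nonneg hd.one_sub_nonneg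
    convert this using 1; abel
  have h2 : algebraMap ℝ (H →L[ℂ] H) (-1) ≤ c + d - 1 := by
    rw [map_neg, map_one, ← sub_nonneg]
    have := add_nonneg hc.nonneg hd.nonneg
    convert this using 1; abel
  exact abs_le.2 ⟨(algebraMap_le_iff_le_spectrum (a := c + d - 1)).1 h2 x hx,
    (le_algebraMap_iff_spectrum_le (a := c + d - 1)).1 h1 x hx⟩

/-- The symmetry `sgn (c + d - 1)` is close to `c + d - 1` if `c` is close to `d`. -/
theorem norm_swapSymm_sub_le {c d : H →L[ℂ] H} (hc : IsStarProjection c)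
    (hd : IsStarProjection d) : ‖(swapSymm c d - (c + d - 1)) Ω‖ ≤ ‖(c - d) Ω‖ := by
  have hS := isSelfAdjoint_add_sub_one hc hd
  have hJ := isSelfAdjoint_swapSymm c d
  refine le_of_sq_le_sq ?_ (norm_nonneg _)
  set M := cfc (fun x : ℝ => |x|) (c + d - 1) with hM
  have h1 : swapSymm c d * (c + d - 1) = M := swapSymm_mul hc hd
  have h2 : (c + d - 1) * swapSymm c d = M := by
    have := congrArg star h1
    rwa [star_mul, hS.star_eq, hJ.star_eq,
      show star M = M from (cfc_predicate (R := ℝ) (p := IsSelfAdjoint) _ _ : IsSelfAdjoint M)] at this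
  have e1 : star (swapSymm c d - (c + d - 1)) * (swapSymm c d - (c + d - 1))
      = 1 - M - M + (c + d - 1) * (c + d - 1) := by
    rw [star_sub, hJ.star_eq, hS.star_eq, sub_mul, mul_sub (swapSymm c d),
      mul_sub (c + d - 1), swapSymm_mul_self, h1, h2]
    abel
  -- With S = c + d - 1, the two sides to compare are 1 - 2|S| + S² and (c - d)² = 1 - S². It is
  -- enough that S² ≤ |S|, which holds since |S| ≤ 1.
  have e2 : (c + d - 1) * (c + d - 1) ≤ M := by
    have : (c + d - 1) * (c + d - 1) = cfc (fun x : ℝ => x * x) (c + d - 1) := by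
      rw [cfc_mul _ _ _ (by fun_prop) (by fun_prop), cfc_id' ℝ (c + d - 1)]
    rw [this]
    refine cfc_mono fun x hx => ?_
    have := abs_le_one_of_mem_spectrum hc hd hx
    rw [← abs_mul_abs_self]
    exact mul_le_of_le_one_left (abs_nonneg _) this
  have e3 : star (c - d) * (c - d) = 1 - (c + d - 1) * (c + d - 1) := by
    rw [sub_sq_of_projections hc hd, star_sub, hc.isSelfAdjoint.star_eq, hd.isSelfAdjoint.star_eq]
    abel
  rw [← reTr_star_mul_self, ← reTr_star_mul_self, e1, e3, reTr_add, reTr_sub, reTr_sub, reTr_sub]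
  have := reTr_mono (Ω := Ω) e2
  linarith

/-- On the kernel, c - d is the symmetry 2c - 1, so there the difference has full size. -/
theorem reTr_swapKer_le {c d : H →L[ℂ] H} (hc : IsStarProjection c) (hd : IsStarProjection d) :
    reTr Ω (swapKer c d) ≤ ‖(c - d) Ω‖ ^ 2 := by
  have hn := isStarProjection_swapKer c d
  have h1 := mul_swapKer c d
  have h2 := commute_swapKer_left hc hd
  have h3 := commute_swapKer_right hc hd
  have e : swapKer c d = (2 * c - 1) * (swapKer c d * (c - d)) := by
    rw [← (h2.sub_left h3).eq, sub_mul c d, h1]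
    have : c * swapKer c d - (1 - c) * swapKer c d = (2 * c - 1) * swapKer c d := by noncomm_ring
    rw [this, ← mul_assoc, two_mul_sub_one_sq hc, one_mul]
  rw [reTr_proj hn]
  refine pow_le_pow_left₀ (norm_nonneg _) ?_ 2
  conv_lhs => rw [e]
  rw [mul_apply_eq_comp, mul_apply_eq_comp]
  exact (norm_apply_le_of_norm_le_one (norm_two_mul_sub_one_le hc) _).trans
    (norm_apply_le_of_norm_le_one (norm_starProjection_le hn) _)

theorem reTr_star (a : H →L[ℂ] H) : reTr Ω (star a) = reTr Ω a := by
  have := reTr_star_mul (Ω := Ω) a 1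
  rw [mul_one] at this
  rw [this, reTr_eq, ← inner_conj_symm, Complex.conj_re]
  rfl

/-- It turns the estimate that is linear in the trace into a two-norm estimate. -/
theorem norm_unitary_sub_one_sq {U : H →L[ℂ] H} (h : star U * U = 1) :
    ‖(U - 1) Ω‖ ^ 2 = -2 * reTr Ω (U - 1) := by
  rw [← reTr_star_mul_self]
  have : star (U - 1) * (U - 1) = -(U - 1) - star (U - 1) := by
    rw [star_sub, star_one, sub_mul, mul_sub, h]; noncomm_ring
  rw [this, reTr_sub, reTr_star, reTr_neg]; ring

/-! ### Rounding a PVM into the corner of one projection -/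

namespace IsPVMIn

variable {A : Type v} [Fintype A] {e : A → H →L[ℂ] H}

/-- A unitary close to one moves a projection into the commutant of a PVM. -/
theorem exists_unitary_near_one (he : IsPVMIn 𝒜 e) (htr : IsTracialVector 𝒜 Ω)
    {P : H →L[ℂ] H} (hP : IsStarProjection P) (hPm : P ∈ 𝒜) :
    ∃ W ∈ 𝒜, W * star W = 1 ∧ star W * W = 1 ∧ (∀ a, Commute (e a) (W * P * star W)) ∧
      ‖(W - 1) Ω‖ ^ 2 ≤ 72 * ∑ a, ‖(e a * P - P * e a) Ω‖ ^ 2 := by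
  -- The projections P and p need not be unitarily equivalent. The first unitary U₀ carries P to p(1
  -- - n) + (1 - p)n; here p commutes with the PVM, but n need not.
  obtain ⟨p, hpm, hp, hpe, hpP⟩ := he.exists_commuting_projection htr hP hPm
  have hnm : swapKer P p ∈ 𝒜 := swapKer_mem hPm hpm
  have hn := isStarProjection_swapKer P p
  have hnp := commute_swapKer_right hP hp
  have hconj := swap_conj hP hp
  have hker := mul_swapKer p P
  rw [swapKer_comm] at hker
  have hU₀ := swap_mul_star (d := p) hP
  have hU₀' := star_mul_swap (d := p) hP
  have hJm : swapSymm P p ∈ 𝒜 := swapSymm_mem hPm hpm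
  have hQm : 2 * P - 1 ∈ 𝒜 := two_mul_sub_one_mem hPm
  have hU₀1 : ‖(swapSymm P p * (2 * P - 1) - 1) Ω‖ ≤ 2 * ‖(P - p) Ω‖ := by
    have e1 : swapSymm P p * (2 * P - 1) - 1 = (swapSymm P p - (2 * P - 1)) * (2 * P - 1) := by
      rw [sub_mul, two_mul_sub_one_sq hP]
    have e2 : (swapSymm P p - (2 * P - 1)) Ω
        = (swapSymm P p - (P + p - 1)) Ω - (P - p) Ω := by
      rw [← sub_apply]; congr 1; noncomm_ring
    rw [e1]
    refine (norm_mul_apply_le_of_norm_le_one htr (sub_mem hJm hQm) hQm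
      (norm_two_mul_sub_one_le hP)).trans ?_
    rw [e2]
    refine (norm_sub_le _ _).trans ?_
    have := norm_swapSymm_sub_le (Ω := Ω) hP hp
    linarith
  have htn := reTr_swapKer_le (Ω := Ω) hP hp
  set n := swapKer P p
  set U₀ := swapSymm P p * (2 * P - 1)
  have hU₀m : U₀ ∈ 𝒜 := mul_mem hJm hQm
  have hmem : ∀ {x}, x ∈ relativeCommutant 𝒜 p ↔ x ∈ 𝒜 ∧ Commute x p :=
    mem_relativeCommutant hp.isSelfAdjoint
  -- The second unitary is sought in the commutant of `p`, so that it moves n and leaves `p` alone.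
  -- Only the trace property is needed there, and it is inherited by the subalgebra.
  have he' : IsPVMIn (relativeCommutant 𝒜 p) e :=
    ⟨fun a => hmem.2 ⟨he.mem a, hpe a⟩, he.proj, he.orth, he.sum_eq⟩
  have htr' : IsTracialVector (relativeCommutant 𝒜 p) Ω := fun a ha b hb =>
    htr a (hmem.1 ha).1 b (hmem.1 hb).1
  obtain ⟨U₁, hU₁m', h1, h2, h3, h4⟩ :=
    exists_unitary_conj_commute htr' he' hn (hmem.2 ⟨hnm, hnp.symm⟩)
  obtain ⟨hU₁m, hU₁p⟩ := hmem.1 hU₁m'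
  have hU₁1 : ‖(U₁ - 1) Ω‖ ^ 2 ≤ 12 * ‖(P - p) Ω‖ ^ 2 := by
    have h5 := h4 1 (one_mem _)
    have h6 : ‖(1 : H →L[ℂ] H)‖ ≤ 1 := ContinuousLinearMap.norm_id_le
    rw [mul_one] at h5
    have h7 := mul_le_mul_of_nonneg_right h6 (reTr_proj_nonneg (Ω := Ω) hn)
    rw [norm_unitary_sub_one_sq h2]
    have := neg_abs_le (reTr Ω (U₁ - 1))
    linarith
  have hU₀n : ‖U₀‖ ≤ 1 := norm_le_one_of_star_mul_eq_one hU₀'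
  refine ⟨U₁ * U₀, mul_mem hU₁m hU₀m, ?_, ?_, fun a => ?_, ?_⟩
  · rw [star_mul, mul_assoc, ← mul_assoc U₀, hU₀, one_mul, h1]
  · rw [star_mul, mul_assoc, ← mul_assoc _ U₁, h2, one_mul, hU₀']
  · have e1 : U₁ * U₀ * P * star (U₁ * U₀)
        = (1 - p) * (U₁ * n * star U₁) + p * (1 - U₁ * n * star U₁) := by
      calc _ = U₁ * (U₀ * P * star U₀) * star U₁ := by rw [star_mul]; simp only [mul_assoc]
        _ = U₁ * ((1 - p) * n + p * (1 - n)) * star U₁ := by rw [hconj, hker]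
        _ = (U₁ * (1 - p)) * n * star U₁ + (U₁ * p) * (1 - n) * star U₁ := by noncomm_ring
        _ = ((1 - p) * U₁) * n * star U₁ + (p * U₁) * (1 - n) * star U₁ := by
          rw [((Commute.one_right U₁).sub_right hU₁p).eq, hU₁p.eq]
        _ = (1 - p) * (U₁ * n * star U₁) + p * (U₁ * star U₁ - U₁ * n * star U₁) := by
          noncomm_ring
        _ = _ := by rw [h1]
    rw [e1]
    exact (((Commute.one_right _).sub_right (hpe a)).mul_right (h3 a)).add_right
      ((hpe a).mul_right ((Commute.one_right _).sub_right (h3 a)))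
  · have e2 : U₁ * U₀ - 1 = (U₁ - 1) * U₀ + (U₀ - 1) := by noncomm_ring
    have e3 : ‖(U₁ * U₀ - 1) Ω‖ ≤ ‖(U₁ - 1) Ω‖ + 2 * ‖(P - p) Ω‖ := by
      rw [e2]
      refine (norm_add_le _ _).trans (add_le_add ?_ hU₀1)
      exact norm_mul_apply_le_of_norm_le_one htr (sub_mem hU₁m (one_mem _)) hU₀m hU₀n
    -- 12 ≤ 4². Together with the 2 from U₀ this gives 6, and 6² · 2 = 72.
    have e4 : ‖(U₁ - 1) Ω‖ ≤ 4 * ‖(P - p) Ω‖ :=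
      le_of_sq_le_sq (by nlinarith [sq_nonneg ‖(P - p) Ω‖]) (by positivity)
    have e5 : ‖(U₁ * U₀ - 1) Ω‖ ≤ 6 * ‖(P - p) Ω‖ := by linarith
    have e6 := pow_le_pow_left₀ (norm_nonneg _) e5 2
    rw [mul_pow] at e6
    linarith

/-- Rounding of a PVM to a PVM in the corner of a projection that almost commutes with it. -/
theorem exists_cornerPVM (he : IsPVMIn 𝒜 e) (htr : IsTracialVector 𝒜 Ω)
    {P : H →L[ℂ] H} (hP : IsStarProjection P) (hPm : P ∈ 𝒜) :
    ∃ R : A → H →L[ℂ] H, (∀ a, R a ∈ 𝒜) ∧ (∀ a, IsStarProjection (R a)) ∧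
      (∀ a, P * R a = R a) ∧ (∀ a, R a * P = R a) ∧ ∑ a, R a = P ∧
      ∑ a, ‖((e a - R a) * P) Ω‖ ^ 2 ≤ 288 * ∑ a, ‖(e a * P - P * e a) Ω‖ ^ 2 := by
  obtain ⟨W, hWm, h1, h2, h3, h4⟩ := he.exists_unitary_near_one htr hP hPm
  have hPP := hP.isIdempotentElem.eq
  set F : A → H →L[ℂ] H := fun a => star W * e a * W with hF
  have hFP : ∀ a, Commute (F a) P := fun a => by
    show star W * e a * W * P = P * (star W * e a * W)
    calc star W * e a * W * P = star W * (e a * (W * P * (star W * W))) := by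
          rw [h2, mul_one]; simp only [mul_assoc]
      _ = star W * (e a * (W * P * star W)) * W := by simp only [mul_assoc]
      _ = star W * W * P * (star W * e a * W) := by rw [(h3 a).eq]; simp only [mul_assoc]
      _ = _ := by rw [h2, one_mul]
  have hFs : ∀ a, IsStarProjection (F a) := fun a => by
    refine ⟨?_, ?_⟩
    · show star W * e a * W * (star W * e a * W) = star W * e a * W
      calc _ = star W * e a * (W * star W) * e a * W := by simp only [mul_assoc]
        _ = star W * (e a * e a) * W := by rw [h1, mul_one]; simp only [mul_assoc]
        _ = _ := by rw [(he.proj a).isIdempotentElem.eq]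
    · show star (star W * e a * W) = star W * e a * W
      rw [star_mul, star_mul, star_star, (he.proj a).isSelfAdjoint.star_eq, mul_assoc]
  have hFm : ∀ a, F a ∈ 𝒜 := fun a => mul_mem (mul_mem (star_mem hWm) (he.mem a)) hWm
  refine ⟨fun a => F a * P, fun a => mul_mem (hFm a) hPm,
    fun a => isStarProjection_mul (hFs a) hP (hFP a), fun a => ?_, fun a => ?_, ?_, ?_⟩
  · show P * (F a * P) = F a * P
    rw [← mul_assoc, ← (hFP a).eq, mul_assoc, hPP]
  · show F a * P * P = F a * P
    rw [mul_assoc, hPP]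
  · rw [← Finset.sum_mul]
    simp only [hF]
    rw [← Finset.sum_mul, ← Finset.mul_sum, he.sum_eq, mul_one, h2, one_mul]
  · have hW : ‖star W‖ ≤ 1 := norm_le_one_of_star_mul_eq_one (by rwa [star_star])
    have hb : ∀ a, ‖((e a - F a * P) * P) Ω‖ ^ 2 ≤ ‖((W - 1) * e a - e a * (W - 1)) Ω‖ ^ 2 := by
      intro a
      refine pow_le_pow_left₀ (norm_nonneg _) ?_ 2
      have e1 : (e a - F a * P) * P = (e a - F a) * P := by rw [sub_mul, mul_assoc, hPP, sub_mul]
      -- All outcomes are conjugated by the same unitary, so the errors are commutators with W - 1.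
      -- Their squares sum to at most 4‖W - 1‖₂², and 4 · 72 = 288.
      have e2 : e a - F a = star W * ((W - 1) * e a - e a * (W - 1)) := by
        have : (W - 1) * e a - e a * (W - 1) = W * e a - e a * W := by noncomm_ring
        rw [this, mul_sub, ← mul_assoc, h2, one_mul, ← mul_assoc]
      rw [e1]
      refine (norm_mul_apply_le_of_norm_le_one htr (sub_mem (he.mem a) (hFm a)) hPm
        (norm_starProjection_le hP)).trans ?_
      rw [e2, mul_apply_eq_comp]
      exact norm_apply_le_of_norm_le_one hW _
    refine (Finset.sum_le_sum fun a _ => hb a).trans ?_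
    have := he.sum_commutator_le htr (sub_mem hWm (one_mem 𝒜))
    linarith

end IsPVMIn

/-! ### Connes' joint distribution argument for a finite spectrum -/

namespace IsPVMIn

variable {A : Type v} [Fintype A] {e : A → H →L[ℂ] H} {N : ℕ} {E : Fin N → H →L[ℂ] H}

theorem mul_sum_smul (hE : IsPVMIn 𝒜 E) (c : Fin N → ℝ) (i : Fin N) :
    E i * ∑ j, c j • E j = c i • E i := by
  rw [Finset.mul_sum, Finset.sum_eq_single i]
  · rw [mul_smul_comm, (hE.proj i).isIdempotentElem.eq]
  · intro j _ hj
    rw [mul_smul_comm, hE.orth i j (Ne.symm hj), smul_zero]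
  · simp

theorem sum_smul_mul (hE : IsPVMIn 𝒜 E) (c : Fin N → ℝ) (i : Fin N) :
    (∑ j, c j • E j) * E i = c i • E i := by
  rw [Finset.sum_mul, Finset.sum_eq_single i]
  · rw [smul_mul_assoc, (hE.proj i).isIdempotentElem.eq]
  · intro j _ hj
    rw [smul_mul_assoc, hE.orth j i hj, smul_zero]
  · simp

theorem real_smul_mem {x : H →L[ℂ] H} (hx : x ∈ 𝒜) (c : ℝ) : c • x ∈ 𝒜 := by
  have : c • x = (c : ℂ) • x := by ext; simp
  rw [this]
  exact 𝒜.toStarSubalgebra.smul_mem hx _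

theorem sum_smul_mem (hE : IsPVMIn 𝒜 E) (c : Fin N → ℝ) : ∑ j, c j • E j ∈ 𝒜 :=
  sum_mem fun j _ => real_smul_mem (hE.mem j) (c j)

theorem sum_sum_norm_sq (hE : IsPVMIn 𝒜 E) (htr : IsTracialVector 𝒜 Ω) {x : H →L[ℂ] H}
    (hx : x ∈ 𝒜) : ∑ i, ∑ j, ‖(E i * x * E j) Ω‖ ^ 2 = ‖x Ω‖ ^ 2 := by
  rw [← hE.sum_norm_sq (x Ω)]
  refine Finset.sum_congr rfl fun i _ => ?_
  rw [hE.sum_norm_sq_right htr (mul_mem (hE.mem i) hx), mul_apply_eq_comp]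

theorem norm_sum_smul_sq (hE : IsPVMIn 𝒜 E) (c : Fin N → ℝ) :
    ‖(∑ j, c j • E j) Ω‖ ^ 2 = ∑ i, c i ^ 2 * ‖E i Ω‖ ^ 2 := by
  rw [← hE.sum_norm_sq]
  refine Finset.sum_congr rfl fun i _ => ?_
  rw [← mul_apply_eq_comp, hE.mul_sum_smul, smul_apply, norm_smul, mul_pow, Real.norm_eq_abs,
    sq_abs]

/-- The joint distribution of the PVM `E` and its conjugates by the elements of `e`. -/
def jointWeight (Ω : H) (e : A → H →L[ℂ] H) (E : Fin N → H →L[ℂ] H) (i j : Fin N) : ℝ :=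
  ∑ a, ‖(E i * e a * E j) Ω‖ ^ 2

theorem jointWeight_nonneg (i j : Fin N) : 0 ≤ jointWeight Ω e E i j := by
  unfold jointWeight; positivity

theorem sum_jointWeight_right (hE : IsPVMIn 𝒜 E) (he : IsPVMIn 𝒜 e) (htr : IsTracialVector 𝒜 Ω)
    (i : Fin N) : ∑ j, jointWeight Ω e E i j = ‖E i Ω‖ ^ 2 := by
  unfold jointWeight
  rw [Finset.sum_comm, ← he.sum_norm_sq_right htr (hE.mem i)]
  refine Finset.sum_congr rfl fun a _ => ?_
  rw [hE.sum_norm_sq_right htr (mul_mem (hE.mem i) (he.mem a))]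

theorem sum_jointWeight_left (hE : IsPVMIn 𝒜 E) (he : IsPVMIn 𝒜 e)
    (j : Fin N) : ∑ i, jointWeight Ω e E i j = ‖E j Ω‖ ^ 2 := by
  unfold jointWeight
  rw [Finset.sum_comm, ← he.sum_norm_sq (E j Ω)]
  refine Finset.sum_congr rfl fun a _ => ?_
  rw [← hE.sum_norm_sq]
  rfl

/-- Between the cells i and j, the commutator of e_a with ∑ c_j E_j is (c_j - c_i) E_i e_a E_j, and
the cells are orthogonal in the two-norm. -/
theorem sum_commutator_sum_smul (hE : IsPVMIn 𝒜 E) (he : IsPVMIn 𝒜 e)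
    (htr : IsTracialVector 𝒜 Ω) (c : Fin N → ℝ) :
    ∑ a, ‖(e a * (∑ j, c j • E j) - (∑ j, c j • E j) * e a) Ω‖ ^ 2
      = ∑ i, ∑ j, jointWeight Ω e E i j * (c i - c j) ^ 2 := by
  have h : ∀ a, ‖(e a * (∑ j, c j • E j) - (∑ j, c j • E j) * e a) Ω‖ ^ 2
      = ∑ i, ∑ j, ‖(E i * e a * E j) Ω‖ ^ 2 * (c i - c j) ^ 2 := fun a => by
    have hD := hE.sum_smul_mem c
    rw [← hE.sum_sum_norm_sq htr
      (sub_mem (mul_mem (he.mem a) hD) (mul_mem hD (he.mem a)))]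
    refine Finset.sum_congr rfl fun i _ => Finset.sum_congr rfl fun j _ => ?_
    have : E i * (e a * (∑ j, c j • E j) - (∑ j, c j • E j) * e a) * E j
        = (c j - c i) • (E i * e a * E j) := by
      calc _ = E i * e a * ((∑ j, c j • E j) * E j) - (E i * ∑ j, c j • E j) * e a * E j := by
            noncomm_ring
        _ = _ := by
            rw [hE.sum_smul_mul, hE.mul_sum_smul, mul_smul_comm, smul_mul_assoc, smul_mul_assoc,
              ← sub_smul]
    rw [this, smul_apply, norm_smul, mul_pow, Real.norm_eq_abs, sq_abs]
    ring
  simp_rw [h, jointWeight, Finset.sum_mul]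
  rw [Finset.sum_comm]
  refine Finset.sum_congr rfl fun i _ => ?_
  rw [Finset.sum_comm]

/-- The discrete layer-cake formula: |i - j| counts the thresholds that separate i from j. -/
theorem sum_indicator_sub_sq {N i j : ℕ} (hi : i < N) (hj : j < N) :
    ∑ n ∈ Finset.range N, ((if n + 1 ≤ i then (1 : ℝ) else 0) - if n + 1 ≤ j then 1 else 0) ^ 2
      = |(i : ℝ) - j| := by
  wlog hij : j ≤ i generalizing i j
  · rw [abs_sub_comm, ← this hj hi (by omega)]
    exact Finset.sum_congr rfl fun n _ => by ring
  have h : ∀ n ∈ Finset.range N,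
      ((if n + 1 ≤ i then (1 : ℝ) else 0) - if n + 1 ≤ j then 1 else 0) ^ 2
        = (if n < i then (1 : ℝ) else 0) - if n < j then 1 else 0 := fun n _ => by
    have : n + 1 ≤ i ↔ n < i := Iff.rfl
    have : n + 1 ≤ j ↔ n < j := Iff.rfl
    split_ifs <;> first | omega | norm_num
  have hc : ∀ k, k < N → ∑ n ∈ Finset.range N, (if n < k then (1 : ℝ) else 0) = k := fun k hk => by
    rw [← Finset.sum_filter]
    have : (Finset.range N).filter (· < k) = Finset.range k := by ext; simp; omega
    rw [this]; simp
  rw [Finset.sum_congr rfl h, Finset.sum_sub_distrib, hc i hi, hc j hj, abs_of_nonneg]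
  exact sub_nonneg.2 (by exact_mod_cast hij)

/-- The spectral projections of a positive element with finite spectrum almost commute with PVMs
that almost commute with the element. -/
theorem sum_commutator_grid_le {X : Type u} [Fintype X] (m : X → ℝ) (hm : ∀ x, 0 ≤ m x)
    (hm1 : ∑ x, m x = 1) {e : X → A → H →L[ℂ] H} (he : ∀ x, IsPVMIn 𝒜 (e x))
    (hE : IsPVMIn 𝒜 E) (htr : IsTracialVector 𝒜 Ω) {η : ℝ} (hη : 0 ≤ η)
    {h : H →L[ℂ] H} (hh : h = ∑ i : Fin N, √(η * (i : ℕ)) • E i)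
    {Q : ℕ → H →L[ℂ] H}
    (hQ : ∀ n, Q n = ∑ i : Fin N, (if n + 1 ≤ (i : ℕ) then (1 : ℝ) else 0) • E i) :
    η * ∑ n ∈ Finset.range N, ∑ x, m x * ∑ a, ‖(e x a * Q n - Q n * e x a) Ω‖ ^ 2
      ≤ 2 * ‖h Ω‖ * √(∑ x, m x * ∑ a, ‖(e x a * h - h * e x a) Ω‖ ^ 2) := by
  set t : Fin N → ℝ := fun i => √(η * (i : ℕ)) with ht
  have ht2 : ∀ i, t i ^ 2 = η * (i : ℕ) := fun i => Real.sq_sqrt (by positivity)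
  set W : Fin N × Fin N → ℝ := fun p => ∑ x, m x * jointWeight Ω (e x) E p.1 p.2 with hW
  have hW0 : ∀ p, 0 ≤ W p := fun p =>
    Finset.sum_nonneg fun x _ => mul_nonneg (hm x) (jointWeight_nonneg _ _)
  have key : ∀ c : Fin N → ℝ, ∑ x, m x * ∑ a,
      ‖(e x a * (∑ j, c j • E j) - (∑ j, c j • E j) * e x a) Ω‖ ^ 2
        = ∑ p, W p * (c p.1 - c p.2) ^ 2 := fun c => by
    have h1 : ∀ x, m x * ∑ a,
        ‖(e x a * (∑ j, c j • E j) - (∑ j, c j • E j) * e x a) Ω‖ ^ 2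
          = ∑ p : Fin N × Fin N, m x * jointWeight Ω (e x) E p.1 p.2 * (c p.1 - c p.2) ^ 2 :=
      fun x => by
        rw [hE.sum_commutator_sum_smul (he x) htr c, Fintype.sum_prod_type, Finset.mul_sum]
        refine Finset.sum_congr rfl fun i _ => ?_
        rw [Finset.mul_sum]
        exact Finset.sum_congr rfl fun j _ => (mul_assoc _ _ _).symm
    rw [Finset.sum_congr rfl fun x _ => h1 x, Finset.sum_comm]
    exact Finset.sum_congr rfl fun p _ => (Finset.sum_mul _ _ _).symm
  have hWr : ∀ i, ∑ j, W (i, j) = ‖E i Ω‖ ^ 2 := fun i => by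
    simp only [hW]
    rw [Finset.sum_comm]
    simp_rw [← Finset.mul_sum, hE.sum_jointWeight_right (he _) htr, ← Finset.sum_mul, hm1, one_mul]
  have hWl : ∀ j, ∑ i, W (i, j) = ‖E j Ω‖ ^ 2 := fun j => by
    simp only [hW]
    rw [Finset.sum_comm]
    simp_rw [← Finset.mul_sum, hE.sum_jointWeight_left (he _), ← Finset.sum_mul, hm1, one_mul]
  have l1 : η * ∑ n ∈ Finset.range N, ∑ x, m x * ∑ a, ‖(e x a * Q n - Q n * e x a) Ω‖ ^ 2
      = ∑ p : Fin N × Fin N, W p * |t p.1 ^ 2 - t p.2 ^ 2| := by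
    simp_rw [hQ, key]
    rw [Finset.sum_comm, Finset.mul_sum]
    refine Finset.sum_congr rfl fun p _ => ?_
    rw [← Finset.mul_sum, sum_indicator_sub_sq p.1.2 p.2.2, ht2, ht2, ← mul_sub, abs_mul,
      abs_of_nonneg hη]
    ring
  -- By (a + b)² ≤ 2a² + 2b² only the marginals of `W` enter, and each gives ‖h‖₂².
  have l2 : ∑ p : Fin N × Fin N, W p * (t p.1 + t p.2) ^ 2 ≤ (2 * ‖h Ω‖) ^ 2 := by
    have : ∀ p : Fin N × Fin N, W p * (t p.1 + t p.2) ^ 2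
        ≤ 2 * (W p * t p.1 ^ 2) + 2 * (W p * t p.2 ^ 2) := fun p => by
      have := hW0 p
      nlinarith [mul_nonneg this (sq_nonneg (t p.1 - t p.2))]
    refine (Finset.sum_le_sum fun p _ => this p).trans ?_
    rw [Finset.sum_add_distrib, ← Finset.mul_sum, ← Finset.mul_sum, Fintype.sum_prod_type,
      Fintype.sum_prod_type_right]
    simp_rw [← Finset.sum_mul, hWr, hWl]
    rw [mul_pow, hh, hE.norm_sum_smul_sq]
    simp_rw [mul_comm (‖E _ Ω‖ ^ 2)]
    apply le_of_eq
    simp only [ht]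
    ring
  rw [l1, hh, key, ← hh]
  -- Cauchy-Schwarz for |t_i² - t_j²| = |t_i + t_j| |t_i - t_j| with the weights `W`.
  have cs := Finset.sum_mul_sq_le_sq_mul_sq Finset.univ
    (fun p : Fin N × Fin N => √(W p) * |t p.1 + t p.2|)
    (fun p : Fin N × Fin N => √(W p) * |t p.1 - t p.2|)
  simp_rw [mul_pow, sq_abs, Real.sq_sqrt (hW0 _)] at cs
  have e1 : ∀ p : Fin N × Fin N, √(W p) * |t p.1 + t p.2| * (√(W p) * |t p.1 - t p.2|)
      = W p * |t p.1 ^ 2 - t p.2 ^ 2| := fun p => by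
    rw [sq_sub_sq, abs_mul]
    nth_rw 3 [← Real.mul_self_sqrt (hW0 p)]
    ring
  simp_rw [e1] at cs
  have hnn : 0 ≤ ∑ p : Fin N × Fin N, W p * (t p.1 - t p.2) ^ 2 :=
    Finset.sum_nonneg fun p _ => mul_nonneg (hW0 p) (sq_nonneg _)
  refine le_of_sq_le_sq ?_ (by positivity)
  rw [mul_pow, Real.sq_sqrt hnn]
  exact cs.trans (mul_le_mul_of_nonneg_right l2 hnn)

end IsPVMIn

variable {σ : H →L[ℂ] H}

/-! ### Spectral decomposition along a grid -/

theorem commute_spectralProjGE_self (hσ : IsSelfAdjoint σ) (s : ℝ) :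
    Commute σ (spectralProjGE σ s) :=
  commute_spectralProjGE (Commute.refl σ) (by rw [hσ.star_eq]) s

/-- From (s - x)⁺ ≤ (t - x)⁺ the kernel for t lies in the kernel for s; the comparison of squares is
sandwiched by the projection for t. -/
theorem spectralProjGE_mul_of_le {s t : ℝ} (hst : s ≤ t) :
    spectralProjGE σ s * spectralProjGE σ t = spectralProjGE σ t := by
  refine kerProj_mul ?_
  set S := cfc (fun x : ℝ => max (s - x) 0) σ with hS
  set T := cfc (fun x : ℝ => max (t - x) 0) σ with hT
  have hSs : star S = S := (cfc_predicate (R := ℝ) (p := IsSelfAdjoint) _ _ : IsSelfAdjoint S)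
  have hST : S * S ≤ T * T := by
    rw [hS, hT, ← cfc_mul _ _ σ (by fun_prop) (by fun_prop),
      ← cfc_mul _ _ σ (by fun_prop) (by fun_prop)]
    refine cfc_mono fun x _ => ?_
    have : max (s - x) 0 ≤ max (t - x) 0 := max_le_max (by linarith) le_rfl
    exact mul_self_le_mul_self (le_max_right _ _) this
  have h1 := star_left_conjugate_le_conjugate hST (spectralProjGE σ t)
  have h2 : T * spectralProjGE σ t = 0 := mul_kerProj _
  have h3 : star (spectralProjGE σ t) * (T * T) * spectralProjGE σ t = 0 := by
    rw [mul_assoc, mul_assoc, h2, mul_zero, mul_zero]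
  have h4 : star (spectralProjGE σ t) * (S * S) * spectralProjGE σ t
      = star (S * spectralProjGE σ t) * (S * spectralProjGE σ t) := by
    rw [star_mul, hSs]; simp only [mul_assoc]
  rw [h3, h4] at h1
  exact CStarRing.star_mul_self_eq_zero_iff _ |>.1 (le_antisymm h1 (star_mul_self_nonneg _))

theorem spectralProjGE_mul_of_le' {s t : ℝ} (hst : s ≤ t) :
    spectralProjGE σ t * spectralProjGE σ s = spectralProjGE σ t := by
  have := congrArg star (spectralProjGE_mul_of_le (σ := σ) hst)
  rwa [star_mul, (isStarProjection_spectralProjGE σ s).isSelfAdjoint.star_eq,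
    (isStarProjection_spectralProjGE σ t).isSelfAdjoint.star_eq] at this

theorem spectralProjGE_of_nonpos (hσ : 0 ≤ σ) {s : ℝ} (hs : s ≤ 0) : spectralProjGE σ s = 1 := by
  have h : cfc (fun x : ℝ => max (s - x) 0) σ = 0 := by
    rw [← cfc_const_zero ℝ σ]
    refine cfc_congr fun x hx => ?_
    have := spectrum_nonneg_of_nonneg hσ hx
    exact max_eq_right (by linarith)
  have := kerProj_mul (T := cfc (fun x : ℝ => max (s - x) 0) σ) (X := 1) (by rw [h, zero_mul])
  rwa [mul_one] at this

theorem spectralProjGE_of_norm_lt (hσ : IsSelfAdjoint σ) {s : ℝ} (hs : ‖σ‖ < s) :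
    spectralProjGE σ s = 0 := by
  have h := spectralProjGE_mul_sub hσ s
  have h0 : cfc (fun x : ℝ => max (x - s) 0) σ = 0 := by
    rw [← cfc_const_zero ℝ σ]
    refine cfc_congr fun x hx => ?_
    have := (le_algebraMap_iff_spectrum_le (a := σ)).1 hσ.le_algebraMap_norm_self x hx
    exact max_eq_right (by linarith)
  rw [h0, mul_sub, sub_eq_zero, ← Algebra.commutes, ← Algebra.smul_def] at h
  have h1 : ‖s • spectralProjGE σ s‖ ≤ ‖spectralProjGE σ s‖ * ‖σ‖ := by
    rw [← h]; exact norm_mul_le _ _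
  rw [norm_smul, Real.norm_of_nonneg ((norm_nonneg σ).trans hs.le)] at h1
  have := norm_nonneg (spectralProjGE σ s)
  exact norm_eq_zero.1 (le_antisymm (by nlinarith) this)

theorem isStarProjection_sub_of_mul {p q : H →L[ℂ] H} (hp : IsStarProjection p)
    (hq : IsStarProjection q) (h1 : p * q = q) (h2 : q * p = q) : IsStarProjection (p - q) := by
  refine ⟨?_, hp.isSelfAdjoint.sub hq.isSelfAdjoint⟩
  show (p - q) * (p - q) = p - q
  rw [sub_mul, mul_sub, mul_sub, hp.isIdempotentElem.eq, hq.isIdempotentElem.eq, h1, h2]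
  abel

/-- On the spectral subspace for `[s, t)`, the operator `σ` is within `t - s` of `s`. -/
theorem norm_sub_apply_le (hσ : IsSelfAdjoint σ) {s t : ℝ} (hst : s ≤ t) (v : H) :
    ‖((spectralProjGE σ s - spectralProjGE σ t) * (σ - algebraMap ℝ _ s)) v‖
      ≤ (t - s) * ‖(spectralProjGE σ s - spectralProjGE σ t) v‖ := by
  have hp := isStarProjection_sub_of_mul (isStarProjection_spectralProjGE σ s)
    (isStarProjection_spectralProjGE σ t) (spectralProjGE_mul_of_le hst)
    (spectralProjGE_mul_of_le' hst)
  have hc : Commute σ (spectralProjGE σ s - spectralProjGE σ t) :=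
    (commute_spectralProjGE_self hσ s).sub_right (commute_spectralProjGE_self hσ t)
  have hs1 : (spectralProjGE σ s - spectralProjGE σ t) * spectralProjGE σ s
      = spectralProjGE σ s - spectralProjGE σ t := by
    rw [sub_mul, (isStarProjection_spectralProjGE σ s).isIdempotentElem.eq,
      spectralProjGE_mul_of_le' hst]
  have ht1 : (spectralProjGE σ s - spectralProjGE σ t) * (1 - spectralProjGE σ t)
      = spectralProjGE σ s - spectralProjGE σ t := by
    rw [mul_sub, mul_one, sub_mul, (isStarProjection_spectralProjGE σ t).isIdempotentElem.eq,
      spectralProjGE_mul_of_le hst, sub_self, sub_zero]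
  have hs2 := spectralProjGE_mul_sub hσ s
  have ht2 := one_sub_spectralProjGE_mul_sub hσ t
  set e := spectralProjGE σ s - spectralProjGE σ t
  set p := cfc (fun x : ℝ => max (x - s) 0) σ
  set q := cfc (fun x : ℝ => max (t - x) 0) σ
  have hp0 : 0 ≤ p := cfc_nonneg fun x _ => le_max_right _ _
  have hq0 : 0 ≤ q := cfc_nonneg fun x _ => le_max_right _ _
  have hpe : Commute p e := hc.cfc_real _
  have hqe : Commute q e := hc.cfc_real _
  have conj : ∀ r, 0 ≤ r → Commute r e → 0 ≤ e * r := fun r hr hre => by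
    have := star_left_conjugate_nonneg hr e
    rwa [hp.isSelfAdjoint.star_eq, mul_assoc, hre.eq, ← mul_assoc, hp.isIdempotentElem.eq] at this
  have hY : e * (σ - algebraMap ℝ _ s) = e * p := by rw [← hs2, ← mul_assoc, hs1]
  have hZ : e * (algebraMap ℝ _ t - σ) = e * q := by rw [← ht2, ← mul_assoc, ht1]
  have hY0 : 0 ≤ e * (σ - algebraMap ℝ _ s) := by rw [hY]; exact conj p hp0 hpe
  have hZ0 : 0 ≤ e * (algebraMap ℝ _ t - σ) := by rw [hZ]; exact conj q hq0 hqe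
  have hYle : e * (σ - algebraMap ℝ _ s) ≤ algebraMap ℝ _ (t - s) := by
    have h1 : e * (σ - algebraMap ℝ _ s) + e * (algebraMap ℝ _ t - σ) = (t - s) • e := by
      rw [← mul_add, sub_add_sub_comm, add_comm σ, add_sub_add_comm, sub_self, add_zero, ← map_sub,
        ← Algebra.commutes, ← Algebra.smul_def]
    have h2 : (t - s) • e ≤ algebraMap ℝ (H →L[ℂ] H) (t - s) := by
      rw [Algebra.algebraMap_eq_smul_one]
      exact smul_le_smul_of_nonneg_left hp.le_one (sub_nonneg.2 hst)
    exact (le_add_of_nonneg_right hZ0).trans (h1.le.trans h2)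
  have hn := (CStarAlgebra.norm_le_iff_le_algebraMap _ (sub_nonneg.2 hst) hY0).2 hYle
  have hYe : e * (σ - algebraMap ℝ _ s) = e * (σ - algebraMap ℝ _ s) * e := by
    have : Commute (σ - algebraMap ℝ _ s) e := hc.sub_left (Algebra.commutes s e)
    rw [mul_assoc, this.eq, ← mul_assoc, hp.isIdempotentElem.eq]
  rw [hYe, mul_apply_eq_comp]
  exact (ContinuousLinearMap.le_opNorm _ _).trans
    (mul_le_mul_of_nonneg_right hn (norm_nonneg _))

/-- The spectral projection `χ_{≥ √t}(σ)`. -/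
def sqrtProj (σ : H →L[ℂ] H) (t : ℝ) : H →L[ℂ] H := spectralProjGE σ (√t)

theorem isStarProjection_sqrtProj (σ : H →L[ℂ] H) (t : ℝ) : IsStarProjection (sqrtProj σ t) :=
  isStarProjection_spectralProjGE _ _

theorem sqrtProj_mem (hσ : σ ∈ 𝒜) (t : ℝ) : sqrtProj σ t ∈ 𝒜 := spectralProjGE_mem hσ _

theorem sqrtProj_mul {s t : ℝ} (h : s ≤ t) : sqrtProj σ s * sqrtProj σ t = sqrtProj σ t :=
  spectralProjGE_mul_of_le (Real.sqrt_le_sqrt h)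

theorem sqrtProj_mul' {s t : ℝ} (h : s ≤ t) : sqrtProj σ t * sqrtProj σ s = sqrtProj σ t :=
  spectralProjGE_mul_of_le' (Real.sqrt_le_sqrt h)

theorem sqrtProj_zero (hσ : 0 ≤ σ) : sqrtProj σ 0 = 1 :=
  spectralProjGE_of_nonpos hσ (by simp)

theorem sqrtProj_of_lt (hσ : IsSelfAdjoint σ) {t : ℝ} (ht : ‖σ‖ ^ 2 < t) : sqrtProj σ t = 0 :=
  spectralProjGE_of_norm_lt hσ (Real.lt_sqrt_of_sq_lt ht)

theorem norm_sqrtProj_apply_antitone (σ : H →L[ℂ] H) (v : H) :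
    Antitone fun t => ‖sqrtProj σ t v‖ ^ 2 := fun s t hst => by
  refine pow_le_pow_left₀ (norm_nonneg _) ?_ 2
  rw [← sqrtProj_mul' hst, mul_apply_eq_comp]
  exact norm_apply_le_of_norm_le_one (norm_starProjection_le (isStarProjection_sqrtProj σ t)) _

/-- The spectral projection of `σ` for the `i`-th cell of the grid of mesh `η`. -/
def gridProj (σ : H →L[ℂ] H) (η : ℝ) (N : ℕ) (i : Fin N) : H →L[ℂ] H :=
  sqrtProj σ (η * (i : ℕ)) - sqrtProj σ (η * ((i : ℕ) + 1 : ℕ))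

section Grid

variable {η : ℝ} {N : ℕ}

theorem sqrtProj_eq_sum_gridProj (hσ : IsSelfAdjoint σ) (hη : 0 ≤ η) (hN : ‖σ‖ ^ 2 < η * N)
    (k : ℕ) :
    sqrtProj σ (η * k) = ∑ i : Fin N, (if k ≤ (i : ℕ) then (1 : ℝ) else 0) • gridProj σ η N i := by
  set p : ℕ → H →L[ℂ] H := fun n => sqrtProj σ (η * n) with hp
  have h : ∀ n, ∑ i ∈ Finset.range n, (if k ≤ i then (1 : ℝ) else 0) • (p i - p (i + 1))
      = if k ≤ n then p k - p n else 0 := fun n => by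
    induction n with
    | zero =>
      rw [Finset.sum_range_zero]
      split_ifs with h
      · rw [Nat.le_zero.1 h, sub_self]
      · rfl
    | succ n ih =>
      rw [Finset.sum_range_succ, ih]
      by_cases h1 : k ≤ n
      · rw [if_pos h1, if_pos h1, if_pos (by omega), one_smul]; abel
      · rw [if_neg h1, if_neg h1, zero_smul, add_zero]
        split_ifs with h2
        · rw [show k = n + 1 by omega, sub_self]
        · rfl
  have h1 : ∑ i : Fin N, (if k ≤ (i : ℕ) then (1 : ℝ) else 0) • gridProj σ η N i
      = ∑ i ∈ Finset.range N, (if k ≤ i then (1 : ℝ) else 0) • (p i - p (i + 1)) := by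
    rw [Finset.sum_range]; rfl
  have hpN : p N = 0 := sqrtProj_of_lt hσ hN
  rw [h1, h]
  split_ifs with hk
  · rw [hpN, sub_zero]
  · refine sqrtProj_of_lt hσ (hN.trans_le ?_)
    exact mul_le_mul_of_nonneg_left (by exact_mod_cast (not_le.1 hk).le) hη

theorem isPVMIn_gridProj (hσ : 0 ≤ σ) (hσm : σ ∈ 𝒜) (hη : 0 ≤ η) (hN : ‖σ‖ ^ 2 < η * N) :
    IsPVMIn 𝒜 (gridProj σ η N) := by
  have hle : ∀ {i j : ℕ}, i ≤ j → η * (i : ℝ) ≤ η * (j : ℝ) := fun h =>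
    mul_le_mul_of_nonneg_left (by exact_mod_cast h) hη
  refine ⟨fun i => sub_mem (sqrtProj_mem hσm _) (sqrtProj_mem hσm _), fun i => ?_,
    fun i j hij => ?_, ?_⟩
  · exact isStarProjection_sub_of_mul (isStarProjection_sqrtProj _ _)
      (isStarProjection_sqrtProj _ _) (sqrtProj_mul (hle (Nat.le_succ _)))
      (sqrtProj_mul' (hle (Nat.le_succ _)))
  · unfold gridProj
    rcases lt_or_gt_of_ne hij with h | h
    · have h : (i : ℕ) + 1 ≤ j := h
      rw [mul_sub, sub_mul, sub_mul, sqrtProj_mul (hle (by omega)), sqrtProj_mul (hle h),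
        sqrtProj_mul (hle (by omega)), sqrtProj_mul (hle (by omega))]
      abel
    · have h : (j : ℕ) + 1 ≤ i := h
      rw [mul_sub, sub_mul, sub_mul, sqrtProj_mul' (hle (by omega)), sqrtProj_mul' (hle h),
        sqrtProj_mul' (hle (by omega)), sqrtProj_mul' (hle (by omega))]
      abel
  · have := sqrtProj_eq_sum_gridProj (IsSelfAdjoint.of_nonneg hσ) hη hN 0
    rw [Nat.cast_zero, mul_zero, sqrtProj_zero hσ] at this
    simpa using this.symm

/-- The discretization of `σ` along the grid of mesh `η` in the spectrum of `σ ^ 2`. -/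
def gridApprox (σ : H →L[ℂ] H) (η : ℝ) (N : ℕ) : H →L[ℂ] H :=
  ∑ i : Fin N, √(η * (i : ℕ)) • gridProj σ η N i

theorem norm_sub_gridApprox_le (hσ : 0 ≤ σ) (hσm : σ ∈ 𝒜) (hη : 0 ≤ η) (hN : ‖σ‖ ^ 2 < η * N)
    (v : H) : ‖(σ - gridApprox σ η N) v‖ ≤ √η * ‖v‖ := by
  have hE : IsPVMIn 𝒜 (gridProj σ η N) := isPVMIn_gridProj hσ hσm hη hN
  refine le_of_sq_le_sq ?_ (by positivity)
  rw [← hE.sum_norm_sq, mul_pow, ← hE.sum_norm_sq v, Finset.mul_sum]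
  refine Finset.sum_le_sum fun i _ => ?_
  rw [← mul_pow]
  refine pow_le_pow_left₀ (norm_nonneg _) ?_ 2
  have h1 : gridProj σ η N i * (σ - gridApprox σ η N)
      = gridProj σ η N i * (σ - algebraMap ℝ _ (√(η * (i : ℕ)))) := by
    rw [mul_sub, mul_sub, gridApprox, hE.mul_sum_smul, ← Algebra.commutes, ← Algebra.smul_def]
  have hle : η * (i : ℕ) ≤ η * ((i : ℕ) + 1 : ℕ) :=
    mul_le_mul_of_nonneg_left (by push_cast; linarith) hη
  have h2 := norm_sub_apply_le (IsSelfAdjoint.of_nonneg hσ) (Real.sqrt_le_sqrt hle) v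
  -- The grid is uniform in σ², and the square root is subadditive, so each cell has width at most
  -- √η in the spectrum of σ.
  have h3 : √(η * ((i : ℕ) + 1 : ℕ)) - √(η * (i : ℕ)) ≤ √η := by
    have : η * ((i : ℕ) + 1 : ℕ) = η * (i : ℕ) + η := by push_cast; ring
    rw [this, sub_le_iff_le_add, add_comm (√η)]
    refine Real.sqrt_le_iff.2 ⟨by positivity, ?_⟩
    nlinarith [Real.sq_sqrt (show 0 ≤ η * (i : ℕ) by positivity), Real.sq_sqrt hη,
      mul_nonneg (Real.sqrt_nonneg (η * (i : ℕ))) (Real.sqrt_nonneg η)]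
  rw [← mul_apply_eq_comp, h1]
  exact h2.trans (mul_le_mul_of_nonneg_right h3 (norm_nonneg _))

theorem sum_norm_sqrtProj_sq (hσ : 0 ≤ σ) (hσm : σ ∈ 𝒜) (hη : 0 ≤ η) (hN : ‖σ‖ ^ 2 < η * N)
    (v : H) : η * ∑ n ∈ Finset.range N, ‖sqrtProj σ (η * (n + 1 : ℕ)) v‖ ^ 2
      = ‖gridApprox σ η N v‖ ^ 2 := by
  have hE : IsPVMIn 𝒜 (gridProj σ η N) := isPVMIn_gridProj hσ hσm hη hN
  rw [gridApprox, hE.norm_sum_smul_sq]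
  simp_rw [sqrtProj_eq_sum_gridProj (IsSelfAdjoint.of_nonneg hσ) hη hN, hE.norm_sum_smul_sq]
  rw [Finset.sum_comm, Finset.mul_sum]
  refine Finset.sum_congr rfl fun i _ => ?_
  rw [← Finset.sum_mul, ← mul_assoc, Real.sq_sqrt (by positivity)]
  congr 2
  have : ∀ n ∈ Finset.range N, (if n + 1 ≤ (i : ℕ) then (1 : ℝ) else 0) ^ 2
      = if n < (i : ℕ) then (1 : ℝ) else 0 := fun n _ => by
    simp only [Nat.succ_le_iff]; split_ifs <;> simp
  rw [Finset.sum_congr rfl this, ← Finset.sum_filter]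
  have h2 : (Finset.range N).filter (· < (i : ℕ)) = Finset.range i := by
    ext; simp; omega
  rw [h2]; simp

end Grid

/-! ### Integration along a grid -/

section GridIntegral

variable {F : ℝ → ℝ} {η : ℝ} {N : ℕ}

/-- The rounded PVMs jump at the grid points, so integrability is checked cell by cell. The cells
(ηn, η(n + 1)] match the ceiling in the choice of the rounding. -/
theorem integrableOn_Ioi_of_grid
    (hF : ∀ n < N, IntegrableOn F (Set.Ioc (η * (n : ℕ)) (η * (n + 1 : ℕ)))) (hη : 0 ≤ η)
    (h0 : ∀ t, η * N < t → F t = 0) : IntegrableOn F (Set.Ioi 0) := by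
  have h1 : IntervalIntegrable F volume (η * (0 : ℕ)) (η * N) :=
    IntervalIntegrable.trans_iterate (a := fun n : ℕ => η * (n : ℕ)) fun k hk => by
      rw [intervalIntegrable_iff_integrableOn_Ioc_of_le
        (mul_le_mul_of_nonneg_left (by exact_mod_cast Nat.le_succ k) hη)]
      exact hF k hk
  rw [Nat.cast_zero, mul_zero, intervalIntegrable_iff_integrableOn_Ioc_of_le (by positivity)] at h1
  refine h1.of_forall_sdiff_eq_zero measurableSet_Ioi fun t ht => h0 t ?_
  by_contra h
  exact ht.2 ⟨ht.1, not_lt.1 h⟩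

theorem integral_Ioi_le_grid (hF : IntegrableOn F (Set.Ioi 0)) (hη : 0 ≤ η)
    (h0 : ∀ t, η * N < t → F t = 0) {g : ℕ → ℝ}
    (hg : ∀ n < N, ∀ t, η * (n : ℕ) < t → t ≤ η * (n + 1 : ℕ) → F t ≤ g n) :
    ∫ t in Set.Ioi (0 : ℝ), F t ≤ η * ∑ n ∈ Finset.range N, g n := by
  have e1 : ∫ t in Set.Ioi (0 : ℝ), F t = ∫ t in Set.Ioc (0 : ℝ) (η * N), F t := by
    refine setIntegral_eq_of_subset_of_forall_sdiff_eq_zero measurableSet_Ioi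
      (fun t ht => ht.1) fun t ht => h0 t ?_
    by_contra h
    exact ht.2 ⟨ht.1, not_lt.1 h⟩
  have hle : ∀ n : ℕ, η * (n : ℕ) ≤ η * (n + 1 : ℕ) := fun n =>
    mul_le_mul_of_nonneg_left (by exact_mod_cast Nat.le_succ n) hη
  have hint : ∀ n : ℕ, IntervalIntegrable F volume (η * (n : ℕ)) (η * (n + 1 : ℕ)) := fun n => by
    rw [intervalIntegrable_iff_integrableOn_Ioc_of_le (hle n)]
    exact hF.mono_set fun t ht => lt_of_le_of_lt (by positivity) ht.1
  have e2 := intervalIntegral.sum_integral_adjacent_intervals (a := fun n : ℕ => η * (n : ℕ))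
    (n := N) fun k _ => hint k
  simp only [Nat.cast_zero, mul_zero] at e2
  rw [e1, ← intervalIntegral.integral_of_le (by positivity), ← e2, Finset.mul_sum]
  refine Finset.sum_le_sum fun n hn => ?_
  rw [intervalIntegral.integral_of_le (hle n)]
  have h3 := (intervalIntegrable_iff_integrableOn_Ioc_of_le (hle n)).1 (hint n)
  have h4 : ∫ t in Set.Ioc (η * (n : ℕ)) (η * (n + 1 : ℕ)), F t
      ≤ ∫ _ in Set.Ioc (η * (n : ℕ)) (η * (n + 1 : ℕ)), g n := by
    refine setIntegral_mono_on h3 (by simp) measurableSet_Ioc fun t ht => ?_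
    exact hg n (Finset.mem_range.1 hn) t ht.1 ht.2
  refine h4.trans (le_of_eq ?_)
  rw [setIntegral_const, smul_eq_mul, measureReal_def, Real.volume_Ioc, ENNReal.toReal_ofReal
    (sub_nonneg.2 (hle n))]
  push_cast; ring

end GridIntegral

theorem exists_grid_size (σ : H →L[ℂ] H) {η : ℝ} (hη : 0 < η) : ∃ N : ℕ, ‖σ‖ ^ 2 < η * N := by
  obtain ⟨N, hN⟩ := exists_nat_gt (‖σ‖ ^ 2 / η)
  exact ⟨N, by rwa [div_lt_iff₀' hη] at hN⟩

theorem integrableOn_norm_sqrtProj_sq (hσ : 0 ≤ σ) (v : H) :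
    IntegrableOn (fun t => ‖sqrtProj σ t v‖ ^ 2) (Set.Ioi 0) := by
  obtain ⟨N, hN⟩ := exists_grid_size σ one_pos
  refine integrableOn_Ioi_of_grid (η := 1) (N := N) (fun n _ => ?_) zero_le_one fun t ht => ?_
  · exact ((norm_sqrtProj_apply_antitone σ v).antitoneOn _).integrableOn_isCompact isCompact_Icc
      |>.mono_set Set.Ioc_subset_Icc_self
  · rw [sqrtProj_of_lt (IsSelfAdjoint.of_nonneg hσ) (hN.trans ht)]; simp

/-- The layer-cake formula for σ². The integrand decreases, so its integral lies between two Riemann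
sums that differ by at most η‖v‖²; the lower one is the squared norm for the discretization of σ.
Then η tends to 0. -/
theorem integral_norm_sqrtProj_sq (hσ : 0 ≤ σ) (hσm : σ ∈ 𝒜) (v : H) :
    ∫ t in Set.Ioi (0 : ℝ), ‖sqrtProj σ t v‖ ^ 2 = ‖σ v‖ ^ 2 := by
  set I := ∫ t in Set.Ioi (0 : ℝ), ‖sqrtProj σ t v‖ ^ 2 with hI
  have hint := integrableOn_norm_sqrtProj_sq hσ v
  have hanti := norm_sqrtProj_apply_antitone σ v
  have key : ∀ η : ℝ, 0 < η → |I - ‖σ v‖ ^ 2| ≤ 2 * η * ‖v‖ ^ 2 + 2 * √η * ‖v‖ * ‖σ v‖ := by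
    intro η hη
    obtain ⟨N, hN⟩ := exists_grid_size σ hη
    have h0 : ∀ t, η * N < t → ‖sqrtProj σ t v‖ ^ 2 = 0 := fun t ht => by
      rw [sqrtProj_of_lt (IsSelfAdjoint.of_nonneg hσ) (hN.trans ht)]; simp
    have hsum := sum_norm_sqrtProj_sq hσ hσm hη.le hN v
    have hup := integral_Ioi_le_grid hint hη.le h0
      (g := fun n => ‖sqrtProj σ (η * (n : ℕ)) v‖ ^ 2) fun n _ t ht _ => hanti ht.le
    have hlow := integral_Ioi_le_grid (F := fun t => -‖sqrtProj σ t v‖ ^ 2) hint.neg hη.le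
      (fun t ht => by rw [h0 t ht, neg_zero])
      (g := fun n => -‖sqrtProj σ (η * (n + 1 : ℕ)) v‖ ^ 2) fun n _ t _ ht => neg_le_neg (hanti ht)
    rw [integral_neg, Finset.sum_neg_distrib, mul_neg, hsum, neg_le_neg_iff, ← hI] at hlow
    have hshift : ∑ n ∈ Finset.range N, ‖sqrtProj σ (η * (n : ℕ)) v‖ ^ 2
        ≤ ∑ n ∈ Finset.range N, ‖sqrtProj σ (η * (n + 1 : ℕ)) v‖ ^ 2 + ‖v‖ ^ 2 := by
      have h1 := Finset.sum_range_succ (fun n : ℕ => ‖sqrtProj σ (η * (n : ℕ)) v‖ ^ 2) N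
      rw [Finset.sum_range_succ'] at h1
      rw [Nat.cast_zero, mul_zero, sqrtProj_zero hσ, show (1 : H →L[ℂ] H) v = v from rfl] at h1
      rw [h1]
      exact le_add_of_nonneg_right (by positivity)
    have hup' := hup.trans (mul_le_mul_of_nonneg_left hshift hη.le)
    rw [mul_add, hsum, ← hI] at hup'
    have hd := norm_sub_gridApprox_le hσ hσm hη.le hN v
    rw [sub_apply] at hd
    have h1 := abs_le.1 ((abs_norm_sub_norm_le (σ v) (gridApprox σ η N v)).trans hd)
    have h2 := Real.sq_sqrt hη.le
    have h3 := norm_nonneg (σ v)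
    have h4 := norm_nonneg (gridApprox σ η N v)
    have h5 : 0 ≤ √η * ‖v‖ := by positivity
    have h6 : (√η * ‖v‖) ^ 2 = η * ‖v‖ ^ 2 := by rw [mul_pow, h2]
    set r := √η * ‖v‖ with hr
    have h7 : 2 * √η * ‖v‖ * ‖σ v‖ = 2 * r * ‖σ v‖ := by rw [hr]; ring
    rw [h7, abs_le]
    constructor
    · nlinarith
    · nlinarith
  have hlim : Filter.Tendsto (fun η : ℝ => 2 * η * ‖v‖ ^ 2 + 2 * √η * ‖v‖ * ‖σ v‖)
      (nhdsWithin 0 (Set.Ioi 0)) (nhds 0) := by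
    have hc : Continuous fun η : ℝ => 2 * η * ‖v‖ ^ 2 + 2 * √η * ‖v‖ * ‖σ v‖ := by fun_prop
    have := hc.tendsto 0
    simp only [Real.sqrt_zero, mul_zero, zero_mul, add_zero] at this
    exact this.mono_left nhdsWithin_le_nhds
  have := ge_of_tendsto hlim (eventually_mem_nhdsWithin.mono fun η hη => key η hη)
  exact sub_eq_zero.1 (abs_nonpos_iff.1 this)

theorem hasOperatorIntegral_sqrtProj (hσ : 0 ≤ σ) (hσm : σ ∈ 𝒜) :
    HasOperatorIntegral (sqrtProj σ) (σ ^ 2) := by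
  have hq : ∀ t u, inner ℂ (sqrtProj σ t u) u = ((‖sqrtProj σ t u‖ ^ 2 : ℝ) : ℂ) := fun t u => by
    have hp := isStarProjection_sqrtProj σ t
    conv_lhs => rw [← hp.isIdempotentElem.eq, mul_apply_eq_comp]
    rw [← ContinuousLinearMap.adjoint_inner_right, ← ContinuousLinearMap.star_eq_adjoint,
      hp.isSelfAdjoint.star_eq, inner_self_eq_norm_sq_to_K]
    norm_cast
  have hq2 : ∀ u, inner ℂ ((σ ^ 2) u) u = ((‖σ u‖ ^ 2 : ℝ) : ℂ) := fun u => by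
    rw [sq, mul_apply_eq_comp, ← ContinuousLinearMap.adjoint_inner_right,
      ← ContinuousLinearMap.star_eq_adjoint, (IsSelfAdjoint.of_nonneg hσ).star_eq,
      inner_self_eq_norm_sq_to_K]
    norm_cast
  have hint : ∀ u, IntegrableOn (fun t => inner ℂ (sqrtProj σ t u) u) (Set.Ioi 0) := fun u => by
    simp_rw [hq]
    exact (integrableOn_norm_sqrtProj_sq hσ u).ofReal
  have hval : ∀ u, ∫ t in Set.Ioi (0 : ℝ), inner ℂ (sqrtProj σ t u) u = inner ℂ ((σ ^ 2) u) u :=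
    fun u => by
      simp_rw [hq]
      rw [hq2, ← integral_norm_sqrtProj_sq hσ hσm, integral_complex_ofReal]
  intro v w
  have hsym : ∀ t, inner ℂ v (sqrtProj σ t w) = inner ℂ (sqrtProj σ t v) w := fun t => by
    rw [← ContinuousLinearMap.adjoint_inner_right, ← ContinuousLinearMap.star_eq_adjoint,
      (isStarProjection_sqrtProj σ t).isSelfAdjoint.star_eq]
  have hsym2 : inner ℂ v ((σ ^ 2) w) = inner ℂ ((σ ^ 2) v) w := by
    rw [← ContinuousLinearMap.adjoint_inner_right, ← ContinuousLinearMap.star_eq_adjoint,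
      ((IsSelfAdjoint.of_nonneg hσ).pow 2).star_eq]
  have hpol := fun T : H →L[ℂ] H => inner_map_polarization' (T : H →ₗ[ℂ] H) v w
  simp only [ContinuousLinearMap.coe_coe] at hpol
  simp_rw [hsym, hsym2, hpol]
  have i1 := hint (v + w)
  have i2 := hint (v - w)
  have i3 := (hint (v + Complex.I • w)).const_mul Complex.I
  have i4 := (hint (v - Complex.I • w)).const_mul Complex.I
  have i12 : IntegrableOn (fun t => inner ℂ (sqrtProj σ t (v + w)) (v + w)
      - inner ℂ (sqrtProj σ t (v - w)) (v - w)) (Set.Ioi 0) := i1.sub i2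
  have i123 : IntegrableOn (fun t => inner ℂ (sqrtProj σ t (v + w)) (v + w)
      - inner ℂ (sqrtProj σ t (v - w)) (v - w) - Complex.I *
        inner ℂ (sqrtProj σ t (v + Complex.I • w)) (v + Complex.I • w)) (Set.Ioi 0) := i12.sub i3
  refine ⟨(i123.add i4).div_const 4, ?_⟩
  rw [integral_div, integral_add i123 i4, integral_sub i12 i3, integral_sub i1 i2,
    integral_const_mul, integral_const_mul, hval, hval, hval, hval]

/-! ### Rounding along the spectral projections -/

theorem isStarProjection_add_of_mul {p q : H →L[ℂ] H} (hp : IsStarProjection p)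
    (hq : IsStarProjection q) (h1 : p * q = 0) (h2 : q * p = 0) : IsStarProjection (p + q) := by
  refine ⟨?_, hp.isSelfAdjoint.add hq.isSelfAdjoint⟩
  show (p + q) * (p + q) = p + q
  rw [add_mul, mul_add, mul_add, hp.isIdempotentElem.eq, hq.isIdempotentElem.eq, h1, h2]
  abel

section Extend

variable {A : Type v} [Fintype A] [DecidableEq A]

/-- Extension of a PVM in the corner of `q` to the corner of the larger projection `p`, by adding
`p - q` to the projection for `a₀`. -/
def extendPVM (a₀ : A) (R : A → H →L[ℂ] H) (q p : H →L[ℂ] H) (a : A) : H →L[ℂ] H :=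
  R a + if a = a₀ then p - q else 0

variable {R : A → H →L[ℂ] H} {p q : H →L[ℂ] H}

theorem isCornerPVM_extendPVM (a₀ : A) (hRm : ∀ a, R a ∈ 𝒜) (hRp : ∀ a, IsStarProjection (R a))
    (hqR : ∀ a, q * R a = R a) (hRq : ∀ a, R a * q = R a) (hsum : ∑ a, R a = q)
    (hq : IsStarProjection q) (hp : IsStarProjection p) (hqm : q ∈ 𝒜) (hpm : p ∈ 𝒜)
    (h1 : p * q = q) (h2 : q * p = q) : IsCornerPVM 𝒜 p (extendPVM a₀ R q p) := by
  have hD := isStarProjection_sub_of_mul hp hq h1 h2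
  have hRp' : ∀ a, R a * p = R a := fun a => by rw [← hRq a, mul_assoc, h2]
  have hpR : ∀ a, p * R a = R a := fun a => by rw [← hqR a, ← mul_assoc, h1]
  refine ⟨fun a => ?_, fun a => ?_, ?_⟩
  · have hm : extendPVM a₀ R q p a ∈ 𝒜 := by
      unfold extendPVM
      refine add_mem (hRm a) ?_
      split_ifs
      exacts [sub_mem hpm hqm, zero_mem _]
    refine ⟨_, hm, ?_⟩
    unfold extendPVM
    split_ifs
    · rw [mul_add, add_mul, hpR, hRp', mul_sub, sub_mul, hp.isIdempotentElem.eq, h1, h2,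
        hp.isIdempotentElem.eq]
    · rw [add_zero, hpR, hRp']
  · unfold extendPVM
    split_ifs
    · refine isStarProjection_add_of_mul (hRp a) hD ?_ ?_
      · rw [mul_sub, hRp', hRq, sub_self]
      · rw [sub_mul, hpR, hqR, sub_self]
    · rw [add_zero]; exact hRp a
  · unfold extendPVM
    rw [Finset.sum_add_distrib, hsum, Finset.sum_ite_eq' Finset.univ a₀, if_pos (Finset.mem_univ _)]
    abel

theorem sum_norm_sub_extendPVM_le {e : A → H →L[ℂ] H} (he : IsPVMIn 𝒜 e) (a₀ : A)
    (hRq : ∀ a, R a * q = R a) (hq : IsStarProjection q) (hp : IsStarProjection p)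
    (h1 : p * q = q) (h2 : q * p = q) :
    ∑ a, ‖((e a - extendPVM a₀ R q p a) * p) Ω‖ ^ 2
      ≤ 2 * ∑ a, ‖((e a - R a) * q) Ω‖ ^ 2 + 8 * (‖p Ω‖ ^ 2 - ‖q Ω‖ ^ 2) := by
  have hD := isStarProjection_sub_of_mul hp hq h1 h2
  have hDn : ‖(p - q) Ω‖ ^ 2 = ‖p Ω‖ ^ 2 - ‖q Ω‖ ^ 2 := by
    rw [← reTr_proj hD, reTr_sub, reTr_proj hp, reTr_proj hq]
  have hRD : ∀ a, R a * (p - q) = 0 := fun a => by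
    rw [← hRq a, mul_assoc, mul_sub, h2, hq.isIdempotentElem.eq, sub_self, mul_zero]
  have hs : ∀ x y : H, ‖x + y‖ ^ 2 ≤ 2 * ‖x‖ ^ 2 + 2 * ‖y‖ ^ 2 := fun x y => by
    have := pow_le_pow_left₀ (norm_nonneg _) (norm_add_le x y) 2
    nlinarith [sq_nonneg (‖x‖ - ‖y‖)]
  have hb : ∀ a, ‖((e a - extendPVM a₀ R q p a) * p) Ω‖ ^ 2
      ≤ 2 * ‖((e a - R a) * q) Ω‖ ^ 2
        + (4 * ‖e a ((p - q) Ω)‖ ^ 2 + if a = a₀ then 4 * ‖(p - q) Ω‖ ^ 2 else 0) := fun a => by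
    have e1 : (e a - extendPVM a₀ R q p a) * p
        = (e a - R a) * q + (e a * (p - q) + if a = a₀ then -(p - q) else 0) := by
      have hDp : (p - q) * p = p - q := by rw [sub_mul, hp.isIdempotentElem.eq, h2]
      have hpe : (e a - R a) * p = (e a - R a) * q + e a * (p - q) := by
        have : (e a - R a) * p = (e a - R a) * q + e a * (p - q) - R a * (p - q) := by
          noncomm_ring
        rw [this, hRD, sub_zero]
      unfold extendPVM
      split_ifs
      · rw [← sub_sub, sub_mul _ (p - q), hDp, hpe]; abel
      · rw [add_zero, add_zero, hpe]
    rw [e1, add_apply]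
    refine (hs _ _).trans (add_le_add le_rfl ?_)
    rw [add_apply, mul_apply_eq_comp]
    have h3 := hs (e a ((p - q) Ω)) ((if a = a₀ then -(p - q) else 0 : H →L[ℂ] H) Ω)
    split_ifs at h3 ⊢
    · rw [neg_apply, norm_neg] at h3
      rw [neg_apply]
      linarith
    · simp only [zero_apply, norm_zero] at h3 ⊢
      linarith
  refine (Finset.sum_le_sum fun a _ => hb a).trans ?_
  rw [Finset.sum_add_distrib, Finset.sum_add_distrib, ← Finset.mul_sum, ← Finset.mul_sum,
    he.sum_norm_sq, Finset.sum_ite_eq' Finset.univ a₀, if_pos (Finset.mem_univ _), hDn]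
  linarith

end Extend

/-- By the trace property the integrand is linear in the spectral projection, so weak integrability
suffices. -/
theorem integrableOn_norm_mul_sqrtProj (htr : IsTracialVector 𝒜 Ω) (hσ : 0 ≤ σ) (hσm : σ ∈ 𝒜)
    {B : H →L[ℂ] H} (hB : B ∈ 𝒜) :
    IntegrableOn (fun t => ‖(B * sqrtProj σ t) Ω‖ ^ 2) (Set.Ioi 0) := by
  have h : ∀ t, ‖(B * sqrtProj σ t) Ω‖ ^ 2
      = RCLike.re (inner ℂ ((star B * B) Ω) (sqrtProj σ t Ω)) := fun t => by
    have hp := isStarProjection_sqrtProj σ t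
    have hpm : sqrtProj σ t ∈ 𝒜 := sqrtProj_mem hσm t
    have h1 := reTr_star_mul (Ω := Ω) (star B * B) (sqrtProj σ t)
    rw [RCLike.re_to_complex, ← h1, ← reTr_star_mul_self, star_mul, star_mul, star_star,
      hp.isSelfAdjoint.star_eq, mul_assoc,
      reTr_comm htr hpm (mul_mem (star_mem hB) (mul_mem hB hpm)), mul_assoc, mul_assoc, mul_assoc,
      hp.isIdempotentElem.eq]
  simp_rw [h]
  exact (hasOperatorIntegral_sqrtProj hσ hσm _ _).1.re

/-- Rounding of PVMs along the spectral projections of `σ`, with an error term from the mesh of a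
grid in the spectrum of `σ ^ 2`. -/
theorem exists_rounding {X : Type u} [Fintype X] {A : Type v} [Fintype A] [Nonempty A]
    {m : X → ℝ} (hm : ∀ x, 0 ≤ m x) (hm1 : ∑ x, m x = 1) {e : X → A → H →L[ℂ] H}
    (he : ∀ x, IsPVMIn 𝒜 (e x)) (htr : IsTracialVector 𝒜 Ω) (hΩ : ‖Ω‖ = 1) (hσ : 0 ≤ σ)
    (hσm : σ ∈ 𝒜) (hσΩ : ‖σ Ω‖ = 1) {η : ℝ} (hη : 0 < η) :
    ∃ E : ℝ → X → A → H →L[ℂ] H, (∀ t, 0 ≤ t → ∀ x, IsCornerPVM 𝒜 (sqrtProj σ t) (E t x)) ∧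
      IntegrableOn (fun t => ∑ x, m x * ∑ a, ‖((e x a - E t x a) * sqrtProj σ t) Ω‖ ^ 2)
        (Set.Ioi 0) ∧
      ∫ t in Set.Ioi (0 : ℝ), ∑ x, m x * ∑ a, ‖((e x a - E t x a) * sqrtProj σ t) Ω‖ ^ 2
        ≤ 1152 * (1 + √η) * √(2 * (∑ x, m x * ∑ a, ‖(e x a * σ - σ * e x a) Ω‖ ^ 2) + 8 * η)
          + 8 * η := by
  classical
  obtain ⟨N, hN⟩ := exists_grid_size σ hη
  have a₀ : A := Classical.arbitrary A
  have hσs := IsSelfAdjoint.of_nonneg hσ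
  have hR := fun (n : ℕ) (x : X) => (he x).exists_cornerPVM htr
    (isStarProjection_sqrtProj σ (η * n)) (sqrtProj_mem hσm (η * n))
  choose R hRm hRp hPR hRP hRs hRe using hR
  -- The level is rounded up to the grid. The projection there is smaller than the one at `t`, so
  -- its rounded PVM only has to be extended by the difference.
  set E : ℝ → X → A → H →L[ℂ] H := fun t x =>
    extendPVM a₀ (R ⌈t / η⌉₊ x) (sqrtProj σ (η * ⌈t / η⌉₊)) (sqrtProj σ t) with hE
  have hceil : ∀ t, t ≤ η * ⌈t / η⌉₊ := fun t => by
    rw [mul_comm, ← div_le_iff₀ hη]; exact Nat.le_ceil _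
  have hceil' : ∀ (n : ℕ) t, η * n < t → t ≤ η * (n + 1 : ℕ) → ⌈t / η⌉₊ = n + 1 := fun n t h1 h2 => by
    rw [Nat.ceil_eq_iff (Nat.succ_ne_zero n), lt_div_iff₀ hη, div_le_iff₀ hη]
    exact ⟨by push_cast; linarith, by linarith⟩
  set F : ℝ → ℝ := fun t => ∑ x, m x * ∑ a, ‖((e x a - E t x a) * sqrtProj σ t) Ω‖ ^ 2 with hF
  have hF0 : ∀ t, η * N < t → F t = 0 := fun t ht => by
    simp only [hF, sqrtProj_of_lt hσs (hN.trans ht)]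
    simp
  have hFint : IntegrableOn F (Set.Ioi 0) := by
    refine integrableOn_Ioi_of_grid (N := N) (fun n _ => ?_) hη.le hF0
    -- On a cell the integrand depends on `t` only through P_t: for Q the projection at the upper
    -- end, (P_t - Q)P_t = (1 - Q)P_t, so the coefficient in front of P_t is constant.
    have h1 : IntegrableOn (fun t => ∑ x, m x * ∑ a, ‖((e x a - R (n + 1) x a +
        if a = a₀ then sqrtProj σ (η * (n + 1 : ℕ)) - 1 else 0) * sqrtProj σ t) Ω‖ ^ 2)
        (Set.Ioc (η * (n : ℕ)) (η * (n + 1 : ℕ))) := by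
      refine integrable_finsetSum _ fun x _ => Integrable.const_mul
        (integrable_finsetSum _ fun a _ => ?_) _
      refine (integrableOn_norm_mul_sqrtProj htr hσ hσm ?_).mono_set
        fun t ht => lt_of_le_of_lt (by positivity) ht.1
      refine add_mem (sub_mem ((he x).mem a) (hRm _ x a)) ?_
      split_ifs
      exacts [sub_mem (sqrtProj_mem hσm _) (one_mem _), zero_mem _]
    refine h1.congr_fun (fun t ht => ?_) measurableSet_Ioc
    simp only [hF, hE, hceil' n t ht.1 ht.2]
    refine Finset.sum_congr rfl fun x _ => congrArg _ (Finset.sum_congr rfl fun a _ => ?_)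
    congr 3
    have hpp := (isStarProjection_sqrtProj σ t).isIdempotentElem.eq
    unfold extendPVM
    split_ifs
    · simp only [sub_mul, add_mul, hpp, one_mul]; abel
    · rw [add_zero, add_zero]
  refine ⟨E, fun t _ x => ?_, hFint, ?_⟩
  · exact isCornerPVM_extendPVM a₀ (hRm _ x) (hRp _ x) (hPR _ x) (hRP _ x) (hRs _ x)
      (isStarProjection_sqrtProj _ _) (isStarProjection_sqrtProj _ _) (sqrtProj_mem hσm _)
      (sqrtProj_mem hσm _) (sqrtProj_mul (hceil t)) (sqrtProj_mul' (hceil t))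
  · set f : ℕ → ℝ := fun n => ‖sqrtProj σ (η * n) Ω‖ ^ 2 with hf
    set ε : ℕ → ℝ := fun n => ∑ x, m x * ∑ a,
      ‖(e x a * sqrtProj σ (η * n) - sqrtProj σ (η * n) * e x a) Ω‖ ^ 2 with hε
    have hanti := norm_sqrtProj_apply_antitone σ Ω
    -- 576 = 2 · 288 comes from the rounding at the upper grid point. The other term is the cost of
    -- the extension, and it telescopes over the cells.
    have hbound : ∀ n < N, ∀ t, η * (n : ℕ) < t → t ≤ η * (n + 1 : ℕ) →
        F t ≤ 576 * ε (n + 1) + 8 * (f n - f (n + 1)) := by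
      intro n _ t h1 h2
      have hx : ∀ x, ∑ a, ‖((e x a - E t x a) * sqrtProj σ t) Ω‖ ^ 2
          ≤ 576 * ∑ a, ‖(e x a * sqrtProj σ (η * (n + 1 : ℕ))
            - sqrtProj σ (η * (n + 1 : ℕ)) * e x a) Ω‖ ^ 2 + 8 * (f n - f (n + 1)) := fun x => by
        have h3 := sum_norm_sub_extendPVM_le (Ω := Ω) (he x) a₀ (hRP (n + 1) x)
          (isStarProjection_sqrtProj _ _) (isStarProjection_sqrtProj σ t)
          (sqrtProj_mul h2) (sqrtProj_mul' h2)
        have h4 := hRe (n + 1) x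
        have h5 : ‖sqrtProj σ t Ω‖ ^ 2 ≤ f n := hanti h1.le
        simp only [hE, hceil' n t h1 h2]
        have h6 : f (n + 1) = ‖sqrtProj σ (η * (n + 1 : ℕ)) Ω‖ ^ 2 := rfl
        linarith
      calc F t ≤ ∑ x, m x * (576 * ∑ a, ‖(e x a * sqrtProj σ (η * (n + 1 : ℕ))
            - sqrtProj σ (η * (n + 1 : ℕ)) * e x a) Ω‖ ^ 2 + 8 * (f n - f (n + 1))) :=
          Finset.sum_le_sum fun x _ => mul_le_mul_of_nonneg_left (hx x) (hm x)
        _ = _ := by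
          simp only [mul_add, Finset.sum_add_distrib, ← Finset.sum_mul, hm1, one_mul, hε,
            Finset.mul_sum]
          congr 1
          refine Finset.sum_congr rfl fun x _ => Finset.sum_congr rfl fun a _ => ?_
          ring
    have h1 := integral_Ioi_le_grid hFint hη.le hF0 hbound
    have hPVM : IsPVMIn 𝒜 (gridProj σ η N) := isPVMIn_gridProj hσ hσm hη.le hN
    have h2 := IsPVMIn.sum_commutator_grid_le m hm hm1 he hPVM htr hη.le
      (h := gridApprox σ η N) rfl (Q := fun n => sqrtProj σ (η * (n + 1 : ℕ)))
      fun n => sqrtProj_eq_sum_gridProj hσs hη.le hN (n + 1)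
    have hd := norm_sub_gridApprox_le hσ hσm hη.le hN Ω
    rw [hΩ, mul_one] at hd
    have h3 : ‖gridApprox σ η N Ω‖ ≤ 1 + √η := by
      have := norm_sub_le (σ Ω) ((σ - gridApprox σ η N) Ω)
      rw [sub_apply, sub_sub_cancel] at this
      rw [sub_apply] at hd
      linarith
    have hgm : gridApprox σ η N ∈ 𝒜 := hPVM.sum_smul_mem _
    -- The discretization changes σ by at most √η in two-norm, so its commutators add at most 4η,
    -- doubled by (a + b)² ≤ 2a² + 2b².
    have h4 : ∑ x, m x * ∑ a, ‖(e x a * gridApprox σ η N - gridApprox σ η N * e x a) Ω‖ ^ 2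
        ≤ 2 * (∑ x, m x * ∑ a, ‖(e x a * σ - σ * e x a) Ω‖ ^ 2) + 8 * η := by
      have hx : ∀ x, ∑ a, ‖(e x a * gridApprox σ η N - gridApprox σ η N * e x a) Ω‖ ^ 2
          ≤ 2 * ∑ a, ‖(e x a * σ - σ * e x a) Ω‖ ^ 2 + 8 * η := fun x => by
        have h5 := (he x).sum_commutator_le htr (sub_mem hσm hgm)
        have h6 : ∀ a, ‖(e x a * gridApprox σ η N - gridApprox σ η N * e x a) Ω‖ ^ 2
            ≤ 2 * ‖(e x a * σ - σ * e x a) Ω‖ ^ 2 +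
              2 * ‖((σ - gridApprox σ η N) * e x a - e x a * (σ - gridApprox σ η N)) Ω‖ ^ 2 :=
          fun a => by
            have : e x a * gridApprox σ η N - gridApprox σ η N * e x a = (e x a * σ - σ * e x a)
              + ((σ - gridApprox σ η N) * e x a - e x a * (σ - gridApprox σ η N)) := by
              noncomm_ring
            rw [this, add_apply]
            have := pow_le_pow_left₀ (norm_nonneg _) (norm_add_le ((e x a * σ - σ * e x a) Ω)
              (((σ - gridApprox σ η N) * e x a - e x a * (σ - gridApprox σ η N)) Ω)) 2
            nlinarith [sq_nonneg (‖(e x a * σ - σ * e x a) Ω‖ -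
              ‖((σ - gridApprox σ η N) * e x a - e x a * (σ - gridApprox σ η N)) Ω‖)]
        have h7 := Finset.sum_le_sum fun a (_ : a ∈ Finset.univ) => h6 a
        rw [Finset.sum_add_distrib, ← Finset.mul_sum, ← Finset.mul_sum] at h7
        have h8 : ‖(σ - gridApprox σ η N) Ω‖ ^ 2 ≤ η := by
          have := pow_le_pow_left₀ (norm_nonneg _) hd 2
          rwa [Real.sq_sqrt hη.le] at this
        linarith
      calc _ ≤ ∑ x, m x * (2 * ∑ a, ‖(e x a * σ - σ * e x a) Ω‖ ^ 2 + 8 * η) :=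
            Finset.sum_le_sum fun x _ => mul_le_mul_of_nonneg_left (hx x) (hm x)
        _ = _ := by
          simp only [mul_add, Finset.sum_add_distrib, ← Finset.sum_mul, hm1, one_mul]
          rw [Finset.mul_sum]
          congr 1
          exact Finset.sum_congr rfl fun x _ => by ring
    have h9 : η * ∑ n ∈ Finset.range N, ε (n + 1) ≤ 2 * (1 + √η) *
        √(2 * (∑ x, m x * ∑ a, ‖(e x a * σ - σ * e x a) Ω‖ ^ 2) + 8 * η) := by
      refine h2.trans ?_
      have := Real.sqrt_le_sqrt h4
      gcongr
    have h10 : ∑ n ∈ Finset.range N, (f n - f (n + 1)) ≤ 1 := by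
      rw [Finset.sum_range_sub']
      have h11 : f 0 = 1 := by
        simp only [hf, Nat.cast_zero, mul_zero, sqrtProj_zero hσ]
        rw [show (1 : H →L[ℂ] H) Ω = Ω from rfl, hΩ, one_pow]
      have h12 : 0 ≤ f N := by positivity
      linarith
    have h13 := mul_le_mul_of_nonneg_left h10 hη.le
    refine h1.trans ?_
    rw [Finset.sum_add_distrib, ← Finset.mul_sum, ← Finset.mul_sum]
    linarith

/-! ### Synchronicity of symmetric strategies -/

/-- Orthogonality follows from the sum: ∑_c ‖e_c e_b v‖² = ‖e_b v‖² is already exhausted by the term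
c = b. -/
theorem IsPVM.isPVMIn {A : Type v} [Fintype A] {e : A → H →L[ℂ] H} (he : IsPVM e)
    (hm : ∀ a, e a ∈ 𝒜) : IsPVMIn 𝒜 e := by
  classical
  have hp : ∀ a, IsStarProjection (e a) := fun a => ⟨he.idem a, (he.pos a).isSelfAdjoint⟩
  refine ⟨hm, hp, fun a b hab => ?_, he.sum_eq⟩
  ext v
  have h1 : ∀ c, reTr (e b v) (e c) = ‖e c (e b v)‖ ^ 2 := fun c => reTr_proj (hp c)
  have h2 : ∑ c, ‖e c (e b v)‖ ^ 2 = ‖e b v‖ ^ 2 := by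
    simp_rw [← h1]
    rw [← reTr_sum, he.sum_eq, reTr_proj (IsStarProjection.one _)]
    rfl
  have h3 : e b (e b v) = e b v := by rw [← mul_apply_eq_comp, he.idem]
  have h4 : ‖e a (e b v)‖ ^ 2 + ‖e b (e b v)‖ ^ 2 ≤ ∑ c, ‖e c (e b v)‖ ^ 2 := by
    rw [← Finset.sum_pair (f := fun c => ‖e c (e b v)‖ ^ 2) hab]
    exact Finset.sum_le_sum_of_subset_of_nonneg (Finset.subset_univ _) fun _ _ _ => by positivity
  rw [h2, h3] at h4
  have h5 : ‖e a (e b v)‖ ^ 2 = 0 := le_antisymm (by linarith) (by positivity)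
  exact norm_eq_zero.1 (pow_eq_zero_iff two_ne_zero |>.1 h5)

theorem IsPVMIn.nonempty {A : Type v} [Fintype A] {e : A → H →L[ℂ] H} (he : IsPVMIn 𝒜 e)
    (hΩ : ‖Ω‖ = 1) : Nonempty A := by
  by_contra h
  rw [not_nonempty_iff] at h
  have h1 := he.sum_eq
  rw [Finset.univ_eq_empty, Finset.sum_empty] at h1
  have h2 : (1 : H →L[ℂ] H) Ω = Ω := rfl
  rw [← h1, zero_apply] at h2
  rw [← h2, norm_zero] at hΩ
  exact zero_ne_one hΩ

section Game

variable {X : Type u} {A : Type v} [Fintype X] [Fintype A]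

theorem NonlocalGame.marginal_nonneg (G : NonlocalGame X A) (x : X) : 0 ≤ G.marginal x :=
  Finset.sum_nonneg fun y _ => G.μ_nonneg x y

theorem NonlocalGame.sum_marginal (G : NonlocalGame X A) : ∑ x, G.marginal x = 1 := G.μ_sum

variable {S : Strategy H X A}

theorem IsSymmetric.correlation_eq (hS : IsSymmetric 𝒜 Ω σ S) (hΩ : IsTracialStandardForm 𝒜 Ω)
    (hσ : IsSelfAdjoint σ) (x : X) (a b : A) :
    S.correlation x x a b = reTr Ω (σ * S.alice x a * σ * S.alice x b) := by
  have h := reTr_star_mul (Ω := Ω) σ (S.alice x a * (σ * S.alice x b))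
  rw [Strategy.correlation, hS.state_eq, hS.bob_eq, mul_apply_eq_comp,
    opMap_apply hΩ (hS.alice_mem x b) hS.mem, ← mul_apply_eq_comp (S.alice x a), ← h, hσ.star_eq]
  simp only [mul_assoc]

theorem IsSymmetric.sum_correlation_eq [DecidableEq A] (hS : IsSymmetric 𝒜 Ω σ S)
    (hΩ : IsTracialStandardForm 𝒜 Ω) (hσ : IsSelfAdjoint σ) (hSp : S.IsProjective) (x : X) :
    (∑ a, ∑ b, if a ≠ b then S.correlation x x a b else 0)
      = 1 - ∑ a, reTr Ω (σ * S.alice x a * σ * S.alice x a) := by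
  have he := (hSp.alice x).isPVMIn (hS.alice_mem x)
  have h1 : ∀ a, (∑ b, if a ≠ b then S.correlation x x a b else 0)
      = ∑ b, S.correlation x x a b - S.correlation x x a a := fun a => by
    rw [eq_sub_iff_add_eq]
    have : S.correlation x x a a = ∑ b, if a = b then S.correlation x x a b else 0 := by
      rw [Finset.sum_ite_eq Finset.univ a, if_pos (Finset.mem_univ a)]
    rw [this, ← Finset.sum_add_distrib]
    refine Finset.sum_congr rfl fun b _ => ?_
    by_cases hab : a = b <;> simp [hab]
  have h2 : ∑ a, ∑ b, S.correlation x x a b = 1 := by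
    simp_rw [hS.correlation_eq hΩ hσ, ← reTr_sum, ← Finset.mul_sum, he.sum_eq, mul_one,
      mul_assoc, ← Finset.mul_sum, ← Finset.sum_mul, he.sum_eq, one_mul]
    have : reTr Ω (σ * σ) = ‖σ Ω‖ ^ 2 := by rw [← reTr_star_mul_self, hσ.star_eq]
    rw [this, ← hS.state_eq, S.norm_ψ, one_pow]
  simp_rw [h1]
  rw [Finset.sum_sub_distrib, h2]
  simp_rw [hS.correlation_eq hΩ hσ]

/-- Each squared commutator sum is 2τ(σ²) - 2∑ τ(σ A_a σ A_a), while the off-diagonal correlations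
sum to 1 - ∑ τ(σ A_a σ A_a), and τ(σ²) = 1. -/
theorem IsSymmetric.sum_commutator_eq [DecidableEq A] (G : NonlocalGame X A)
    (hS : IsSymmetric 𝒜 Ω σ S) (hΩ : IsTracialStandardForm 𝒜 Ω) (hσ : IsSelfAdjoint σ)
    (hSp : S.IsProjective) :
    ∑ x, G.marginal x * ∑ a, ‖(S.alice x a * σ - σ * S.alice x a) Ω‖ ^ 2
      = 2 * S.synchronicity G := by
  have he := fun x => (hSp.alice x).isPVMIn (hS.alice_mem x)
  have htr : IsTracialVector 𝒜 Ω := hΩ.tracial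
  have h1 : reTr Ω (σ * σ) = 1 := by
    rw [← one_pow (M := ℝ) 2, ← S.norm_ψ, hS.state_eq, ← reTr_star_mul_self, hσ.star_eq]
  rw [Strategy.synchronicity, NonlocalGame.expect, Finset.mul_sum]
  refine Finset.sum_congr rfl fun x _ => ?_
  rw [hS.sum_correlation_eq hΩ hσ hSp, (he x).sum_commutator_eq htr hS.mem hσ, h1]
  ring

theorem IsSymmetric.synchronicity_le_one [DecidableEq A] (G : NonlocalGame X A)
    (hS : IsSymmetric 𝒜 Ω σ S) (hΩ : IsTracialStandardForm 𝒜 Ω) (hσ : IsSelfAdjoint σ)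
    (hSp : S.IsProjective) : S.synchronicity G ≤ 1 := by
  have he := fun x => (hSp.alice x).isPVMIn (hS.alice_mem x)
  have htr : IsTracialVector 𝒜 Ω := hΩ.tracial
  -- By the trace property this is ‖A σ A‖₂² with A = A^x_a.
  have h1 : ∀ x a, 0 ≤ reTr Ω (σ * S.alice x a * σ * S.alice x a) := fun x a => by
    have hm := (he x).mem a
    have hp := (he x).proj a
    have h2 := reTr_star_mul_self (Ω := Ω) (S.alice x a * (σ * S.alice x a))
    rw [star_mul, star_mul, hσ.star_eq, hp.isSelfAdjoint.star_eq, mul_assoc,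
      ← mul_assoc (S.alice x a) (S.alice x a), hp.isIdempotentElem.eq, mul_assoc,
      reTr_comm htr hm (mul_mem hS.mem (mul_mem hm (mul_mem hS.mem hm)))] at h2
    have h3 : σ * (S.alice x a * (σ * S.alice x a)) * S.alice x a
        = σ * S.alice x a * σ * S.alice x a := by
      simp only [mul_assoc, hp.isIdempotentElem.eq]
    rw [h3] at h2
    rw [h2]; positivity
  rw [Strategy.synchronicity, NonlocalGame.expect, ← G.sum_marginal]
  refine Finset.sum_le_sum fun x _ => ?_
  rw [hS.sum_correlation_eq hΩ hσ hSp]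
  refine mul_le_of_le_one_right (G.marginal_nonneg x) ?_
  have := Finset.sum_nonneg fun a (_ : a ∈ Finset.univ) => h1 x a
  linarith

end Game

/-- PVMs that commute with `σ` restrict to the spectral projections of `σ`. -/
theorem exists_rounding_of_commute {X : Type u} [Fintype X] {A : Type v} [Fintype A] [Nonempty A]
    {m : X → ℝ} {e : X → A → H →L[ℂ] H} (he : ∀ x, IsPVMIn 𝒜 (e x))
    (hσm : σ ∈ 𝒜) (hc : ∀ x, m x ≠ 0 → ∀ a, Commute (e x a) σ) :
    ∃ E : ℝ → X → A → H →L[ℂ] H, (∀ t, 0 ≤ t → ∀ x, IsCornerPVM 𝒜 (sqrtProj σ t) (E t x)) ∧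
      ∀ t, ∑ x, m x * ∑ a, ‖((e x a - E t x a) * sqrtProj σ t) Ω‖ ^ 2 = 0 := by
  classical
  have a₀ : A := Classical.arbitrary A
  -- Questions of probability zero need not commute with σ; they get the trivial PVM that puts
  -- everything on one answer.
  refine ⟨fun t x => if m x = 0 then extendPVM a₀ 0 0 (sqrtProj σ t) else
    fun a => e x a * sqrtProj σ t, fun t _ x => ?_, fun t => Finset.sum_eq_zero fun x _ => ?_⟩
  · have hP := isStarProjection_sqrtProj σ t
    have hPm : sqrtProj σ t ∈ 𝒜 := sqrtProj_mem hσm t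
    by_cases hx : m x = 0
    · simp only [if_pos hx]
      exact isCornerPVM_extendPVM a₀ (fun _ => zero_mem _) (fun _ => IsStarProjection.zero _)
        (fun _ => zero_mul _) (fun _ => mul_zero _) (by simp) (IsStarProjection.zero _) hP
        (zero_mem _) hPm (mul_zero _) (zero_mul _)
    · simp only [if_neg hx]
      have hcP : ∀ a, Commute (e x a) (sqrtProj σ t) := fun a =>
        commute_spectralProjGE (hc x hx a)
          (by rw [((he x).proj a).isSelfAdjoint.star_eq]; exact hc x hx a) _
      refine ⟨fun a => ⟨e x a, (he x).mem a, ?_⟩, fun a => isStarProjection_mul ((he x).proj a) hP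
        (hcP a), ?_⟩
      · rw [← (hcP a).eq, mul_assoc, hP.isIdempotentElem.eq]
      · rw [← Finset.sum_mul, (he x).sum_eq, one_mul]
  · by_cases hx : m x = 0
    · rw [hx, zero_mul]
    · simp only [if_neg hx, sub_mul, mul_assoc, (isStarProjection_sqrtProj σ t).isIdempotentElem.eq]
      simp

end Rounding

end

/-! ### The rounding theorem -/

theorem proposition4p2 :
    ∃ C : ℝ, 0 < C ∧
      ∀ (X : Type u) (A : Type v) [Fintype X] [Fintype A] [DecidableEq A]
        (G : Rounding.NonlocalGame X A) (_ : G.IsSynchronous)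
        (H : Type w) [NormedAddCommGroup H] [InnerProductSpace ℂ H] [CompleteSpace H]
        (𝒜 : VonNeumannAlgebra H) (Ω : H) (_ : Rounding.IsTracialStandardForm 𝒜 Ω)
        (σ : H →L[ℂ] H) (_ : σ.IsPositive)
        (S : Rounding.Strategy H X A) (_ : Rounding.IsSymmetric 𝒜 Ω σ S) (_ : S.IsProjective)
        (δ : ℝ) (_ : S.IsDeltaSynchronous G δ),
        ∃ P : ℝ → H →L[ℂ] H,
          (∀ t, 0 ≤ t → P t = Rounding.spectralProjGE σ (Real.sqrt t)) ∧
          (∀ t, 0 ≤ t → P t ∈ 𝒜 ∧ IsStarProjection (P t)) ∧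
          Rounding.HasOperatorIntegral P (σ ^ 2) ∧
          ∃ E : ℝ → X → A → H →L[ℂ] H,
            (∀ t, 0 ≤ t → ∀ x, Rounding.IsCornerPVM 𝒜 (P t) (E t x)) ∧
            IntegrableOn
              (fun t => G.expect fun x =>
                ∑ a, Rounding.twoNorm Ω ((S.alice x a - E t x a) * P t) ^ 2) (Set.Ioi 0) ∧
            ∫ t in Set.Ioi (0 : ℝ), (G.expect fun x =>
                ∑ a, Rounding.twoNorm Ω ((S.alice x a - E t x a) * P t) ^ 2)
              ≤ C * δ ^ (1 / 4 : ℝ) := by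
  -- 9224 = 1152 · 2 · 4 + 8, from the bound of `exists_rounding` with η = s, √s ≤ 1 and √(12s) ≤
  -- 4√s.
  refine ⟨9224, by norm_num, ?_⟩
  intro X A _ _ _ G _ H _ _ _ 𝒜 Ω hΩ σ hσp S hS hSp δ hδ
  have hσ : 0 ≤ σ := (ContinuousLinearMap.nonneg_iff_isPositive σ).2 hσp
  have hσs := hσp.isSelfAdjoint
  have hσm := hS.mem
  have he := fun x => (hSp.alice x).isPVMIn (hS.alice_mem x)
  have htr : Rounding.IsTracialVector 𝒜 Ω := hΩ.tracial
  have hD := hS.sum_commutator_eq G hΩ hσs hSp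
  have hle := hS.synchronicity_le_one G hΩ hσs hSp
  have hσΩ : ‖σ Ω‖ = 1 := by rw [← hS.state_eq, S.norm_ψ]
  have hX : Nonempty X := by
    by_contra h
    rw [not_nonempty_iff] at h
    have := G.μ_sum
    simp at this
  have hA : Nonempty A := (he hX.some).nonempty hΩ.norm_eq_one
  have hδ' : S.synchronicity G ≤ δ := hδ
  -- The estimates use the exact synchronicity, which is at most 1, instead of δ, which may be
  -- large.
  set s := S.synchronicity G
  have hterm : ∀ x, 0 ≤ G.marginal x * ∑ a, ‖(S.alice x a * σ - σ * S.alice x a) Ω‖ ^ 2 :=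
    fun x => mul_nonneg (G.marginal_nonneg x) (by positivity)
  have hs0 : 0 ≤ s := by
    have := Finset.sum_nonneg fun x (_ : x ∈ Finset.univ) => hterm x
    linarith
  refine ⟨Rounding.sqrtProj σ, fun t _ => rfl, fun t _ => ⟨Rounding.sqrtProj_mem hσm t,
    Rounding.isStarProjection_sqrtProj σ t⟩, Rounding.hasOperatorIntegral_sqrtProj hσ hσm, ?_⟩
  simp only [Rounding.NonlocalGame.expect, Rounding.twoNorm_sq]
  -- The mesh η = s must be positive. If s = 0, the operators commute with σ for every question of
  -- positive probability, since `Ω` is separating, and restriction to the spectral projections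
  -- makes no error.
  rcases hs0.eq_or_lt with h0 | hpos
  · have hc : ∀ x, G.marginal x ≠ 0 → ∀ a, Commute (S.alice x a) σ := fun x hx a => by
      rw [← h0, mul_zero, Finset.sum_eq_zero_iff_of_nonneg fun x _ => hterm x] at hD
      have h1 := (mul_eq_zero.1 (hD x (Finset.mem_univ x))).resolve_left hx
      rw [Finset.sum_eq_zero_iff_of_nonneg fun a _ => by positivity] at h1
      have h2 := norm_eq_zero.1 (pow_eq_zero_iff two_ne_zero |>.1 (h1 a (Finset.mem_univ a)))
      exact sub_eq_zero.1 (hΩ.separating _ (sub_mem (mul_mem ((he x).mem a) hσm)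
        (mul_mem hσm ((he x).mem a))) h2)
    obtain ⟨E, hE, hE0⟩ := Rounding.exists_rounding_of_commute (Ω := Ω) he hσm hc
    refine ⟨E, hE, ?_, ?_⟩
    · simp only [hE0]
      exact integrableOn_zero
    · simp only [hE0, integral_zero]
      have : 0 ≤ δ := hs0.trans hδ'
      positivity
  · obtain ⟨E, hE, hint, hbd⟩ := Rounding.exists_rounding G.marginal_nonneg G.sum_marginal he htr
      hΩ.norm_eq_one hσ hσm hσΩ hpos
    refine ⟨E, hE, hint, hbd.trans ?_⟩
    rw [hD]
    have h1 : √(2 * (2 * s) + 8 * s) ≤ 4 * √s := by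
      rw [show 2 * (2 * s) + 8 * s = 12 * s by ring]
      refine Real.sqrt_le_iff.2 ⟨by positivity, ?_⟩
      rw [mul_pow, Real.sq_sqrt hs0]; linarith
    have h2 : √s ≤ 1 := Real.sqrt_le_one.2 hle
    have h3 : s ≤ √s := by
      nlinarith [Real.mul_self_sqrt hs0, Real.sqrt_nonneg s]
    have h4 : √s ≤ δ ^ (1 / 4 : ℝ) := by
      rw [Real.sqrt_eq_rpow]
      exact (Real.rpow_le_rpow_of_exponent_ge hpos hle (by norm_num)).trans
        (Real.rpow_le_rpow hs0 hδ' (by norm_num))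
    have h5 : 1152 * (1 + √s) * √(2 * (2 * s) + 8 * s) ≤ 1152 * 2 * (4 * √s) := by
      gcongr; linarith
    linarith
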